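/- Let $\kappa$ be a regular uncountable cardinal and let $\mathcal I$ be a $\kappa$-complete proper ideal on $\kappa$ (the union of fewer than $\kappa$ members of $\mathcal I$ is in $\mathcal I$, and $\mathcal I\neq\mathscr P(\kappa)$) that contains every bounded subset of $\kappa$. For $\nu\in\{2,\kappa\}$ let $\tau_{\mathcal I}$ be the topology on ${}^{\kappa}\nu$ generated by the sets $\{x\in{}^{\kappa}\nu : f\subseteq x\}$, where $f\colon D\to\nu$ and $D\in\mathcal I$. Let $\mathcal I\text{-}\mathbf{Bor}({}^\kappa\nu)$ be the smallest family of subsets of ${}^\kappa\nu$ that contains the $\tau_{\mathcal I}$-open sets and is closed under complements and unions of at most $\kappa$ members. Let $\boldsymbol\Sigma^0_1$ be the class of $\tau_{\mathcal I}$-open sets and, for ordinals $\alpha>1$, let $\boldsymbol\Sigma^0_\alpha$ be the class of all unions $\bigcup_{\gamma<\kappa}A_\gamma$ such that each $A_\gamma$ is the complement of a set in $\boldsymbol\Sigma^0_\beta$ for some $1\le\beta<\alpha$. Then, for $\nu=2$ and for $\nu=\kappa$, the hierarchy does not collapse: there is no ordinal $1\le\alpha<\kappa^+$ with $\boldsymbol\Sigma^0_\alpha=\mathcal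 I\text{-}\mathbf{Bor}({}^\kappa\nu)$. Therefore it has length $\kappa^+$ on both spaces: $\kappa^+$ is the least ordinal $\alpha\ge 1$ with $\boldsymbol\Sigma^0_\alpha=\mathcal I\text{-}\mathbf{Bor}({}^\kappa\nu)$; for all $1\le\alpha<\beta<\kappa^+$ we have $\boldsymbol\Sigma^0_\beta\not\subseteq\boldsymbol\Sigma^0_\alpha$; and $\boldsymbol\Sigma^0_\alpha\subsetneq\boldsymbol\Sigma^0_\beta$ for all $1\le\alpha<\beta<\kappa^+$ with $(\alpha,\beta)\ne(1,2)$. (Hence $\boldsymbol\Sigma^0_1\subsetneq\boldsymbol\Sigma^0_2$ as well whenever $\boldsymbol\Sigma^0_1\subseteq\boldsymbol\Sigma^0_2$.) -/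

import Mathlib

open Cardinal Ordinal
open scoped Topology

universe u v

namespace IdealBorel

/-- An ideal `I` of subsets of `K` is `κ`-complete: the union of fewer than `κ` members
of `I` is a member of `I`. -/
def IsComplete {K : Type u} (κ : Cardinal.{u}) (I : Order.Ideal (Set K)) : Prop :=
  ∀ J : Set (Set K), (∀ D ∈ J, D ∈ I) → #J < κ → ⋃₀ J ∈ I

/-- `I` extends the ideal of bounded sets. -/
def ExtendsBounded {K : Type u} [LinearOrder K] (I : Order.Ideal (Set K)) : Prop :=
  ∀ D : Set K, BddAbove D → D ∈ I

/-- The cone of a partial function `f : D → ν`: all total functions that extend `f`. -/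
def cone {K : Type u} {ν : Type v} {D : Set K} (f : D → ν) : Set (K → ν) :=
  {x | ∀ i : D, x i = f i}

/-- The topology on `K → ν` generated by the cones of the partial functions
whose domain belongs to `I`. -/
@[reducible] def idealTopology {K : Type u} (I : Order.Ideal (Set K)) (ν : Type v) :
    TopologicalSpace (K → ν) :=
  TopologicalSpace.generateFrom {N | ∃ D ∈ I, ∃ f : D → ν, N = cone f}

/-- `IsSigma κ τ α A`: the set `A` belongs to the additive class `Σ⁰_α` of the `κ⁺`-Borel
hierarchy of the topology `τ`. The class `Σ⁰_1` consists of the open sets; for `α > 1`, the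
members of `Σ⁰_α` are the unions of `κ`-sequences of sets each of which is the complement
of a set in `Σ⁰_β` for some `1 ≤ β < α`. -/
inductive IsSigma (κ : Cardinal.{u}) {X : Type u} (τ : TopologicalSpace X) :
    Ordinal.{u} → Set X → Prop
  | of_isOpen (U : Set X) (hU : IsOpen[τ] U) : IsSigma κ τ 1 U
  | iUnion (α : Ordinal.{u}) (hα : 1 < α) (A : κ.ord.ToType → Set X)
      (β : κ.ord.ToType → Ordinal.{u}) (hβ : ∀ i, 1 ≤ β i) (hβα : ∀ i, β i < α)
      (hA : ∀ i, IsSigma κ τ (β i) (A i)ᶜ) : IsSigma κ τ α (⋃ i, A i)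

/-- The class `Σ⁰_α` of the `κ⁺`-Borel hierarchy of `τ` (meaningful for `α ≥ 1`;
it is empty for `α = 0`). -/
def sigmaClass (κ : Cardinal.{u}) {X : Type u} (τ : TopologicalSpace X) (α : Ordinal.{u}) :
    Set (Set X) :=
  {A | IsSigma κ τ α A}

/-- A `κ⁺`-algebra of subsets of `X`: closed under complements and under unions of
at most `κ` members. -/
structure IsSuccAlgebra (κ : Cardinal.{u}) {X : Type u} (𝒜 : Set (Set X)) : Prop where
  compl_mem : ∀ A ∈ 𝒜, Aᶜ ∈ 𝒜
  sUnion_mem : ∀ 𝒥 : Set (Set X), 𝒥 ⊆ 𝒜 → #𝒥 ≤ κ → ⋃₀ 𝒥 ∈ 𝒜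

/-- The `κ⁺`-Borel sets of `τ`: the smallest `κ⁺`-algebra that contains the open sets. -/
def borelClass (κ : Cardinal.{u}) {X : Type u} (τ : TopologicalSpace X) : Set (Set X) :=
  ⋂₀ {𝒜 | IsSuccAlgebra κ 𝒜 ∧ {U | IsOpen[τ] U} ⊆ 𝒜}

/-- The `κ⁺`-Borel hierarchy of `τ` collapses: some class `Σ⁰_α` with `1 ≤ α < κ⁺` already
contains exactly the `κ⁺`-Borel sets. -/
def Collapses (κ : Cardinal.{u}) {X : Type u} (τ : TopologicalSpace X) : Prop :=
  ∃ α : Ordinal.{u}, 1 ≤ α ∧ α < (Order.succ κ).ord ∧ sigmaClass κ τ α = borelClass κ τ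

/-- The `κ⁺`-Borel hierarchy of `τ` has length `κ⁺`. The first field says that `κ⁺` is the least
`α ≥ 1` with `Σ⁰_α` equal to the class of `κ⁺`-Borel sets. The other two say that the classes
`Σ⁰_α`, `1 ≤ α < κ⁺`, are strictly increasing, where only the inclusion of `Σ⁰_1` in `Σ⁰_2` is
not claimed (an open set need not be a union of `κ` many closed sets). -/
structure HasFullLength (κ : Cardinal.{u}) {X : Type u} (τ : TopologicalSpace X) : Prop where
  isLeast : IsLeast {α : Ordinal.{u} | 1 ≤ α ∧ sigmaClass κ τ α = borelClass κ τ}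
    (Order.succ κ).ord
  not_subset : ∀ α β : Ordinal.{u}, 1 ≤ α → α < β → β < (Order.succ κ).ord →
    ¬ sigmaClass κ τ β ⊆ sigmaClass κ τ α
  ssubset : ∀ α β : Ordinal.{u}, 1 ≤ α → α < β → β < (Order.succ κ).ord →
    ¬ (α = 1 ∧ β = 2) → sigmaClass κ τ α ⊂ sigmaClass κ τ β
end IdealBorel

/-!
Every set of class `Σ⁰_α`, `α < κ⁺`, arises from `κ` many open sets by one fixed Boolean operation
on `κ`-sequences of sets, which depends only on `α`. By diagonalization it is enough to find `κ`
many Borel sets `Z j` such that for all open sets `U j` some point `x` belongs to `U j` if and only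
if it belongs to `Z j`, for every `j`.

Points are coded by subsets of `κ`. A subset `x` has events at some `i < κ`, each with a label `j`
and a sign, and `Z j` says that there is a last event of label `j` and that it is positive. The
point `x` is built in `κ` stages. Stage `k` decides a null set of `x` that settles whether
`x ∈ U k`, and then adds one event of label `k` whose sign records the answer. No later stage adds
an event of label `k`, because labels below the current stage are avoided.

If `κ` splits into `κ` many positive sets, then a map with positive fibres assigns labels and signs
to the elements of `κ`, and the members of `x` are the events. Otherwise the ideal is saturated,
and on a positive set there is a least unbounded function `g`: every function below `g` is bounded
almost everywhere. The image under `g` of any large set reflects at some `i`, that is, `i` is a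
regular uncountable cardinal in which the image is stationary. There is an event at `i` if `g '' x`
reflects at `i`, and label and sign are read off from the germ of `g '' x` at `i`.
-/

namespace IdealBorel

open Filter Order

section Hierarchy

variable {κ : Cardinal.{u}} {X : Type u} {τ : TopologicalSpace X} {α β : Ordinal.{u}} {A : Set X}

theorem IsSigma.one_le (h : IsSigma κ τ α A) : 1 ≤ α := by
  cases h with
  | of_isOpen U hU => exact le_rfl
  | iUnion α hα => exact hα.le

theorem isSigma_one_iff : IsSigma κ τ 1 A ↔ IsOpen[τ] A := by
  refine ⟨fun h => ?_, .of_isOpen A⟩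
  generalize hα : (1 : Ordinal.{u}) = α at h
  cases h with
  | of_isOpen U hU => exact hU
  | iUnion α h1 => exact absurd hα h1.ne

theorem isSigma_iff (hα : 1 < α) :
    IsSigma κ τ α A ↔ ∃ B : κ.ord.ToType → Set X,
      (∀ i, ∃ β, 1 ≤ β ∧ β < α ∧ IsSigma κ τ β (B i)ᶜ) ∧ A = ⋃ i, B i := by
  refine ⟨fun h => ?_, ?_⟩
  · cases h with
    | of_isOpen U hU => exact absurd hα (lt_irrefl _)
    | iUnion α hα B β hβ hβα hB => exact ⟨B, fun i => ⟨β i, hβ i, hβα i, hB i⟩, rfl⟩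
  · rintro ⟨B, hB, rfl⟩
    choose β hβ hβα hB using hB
    exact .iUnion α hα B β hβ hβα hB

theorem isSuccAlgebra_borelClass : IsSuccAlgebra κ (borelClass κ τ) where
  compl_mem A hA 𝒜 h𝒜 := h𝒜.1.compl_mem A (hA 𝒜 h𝒜)
  sUnion_mem 𝒥 h𝒥 hcard 𝒜 h𝒜 := h𝒜.1.sUnion_mem 𝒥 (fun _ hA => h𝒥 hA 𝒜 h𝒜) hcard

theorem mem_borelClass_of_isOpen (h : IsOpen[τ] A) : A ∈ borelClass κ τ :=
  fun _ h𝒜 => h𝒜.2 h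

theorem IsSuccAlgebra.iUnion_mem {𝒜 : Set (Set X)} (h : IsSuccAlgebra κ 𝒜)
    {B : κ.ord.ToType → Set X} (hB : ∀ i, B i ∈ 𝒜) : ⋃ i, B i ∈ 𝒜 := by
  rw [← Set.sUnion_range]
  exact h.sUnion_mem _ (Set.range_subset_iff.2 hB) (mk_range_le.trans (mk_ord_toType κ).le)

theorem IsSuccAlgebra.iInter_mem {𝒜 : Set (Set X)} (h : IsSuccAlgebra κ 𝒜)
    {B : κ.ord.ToType → Set X} (hB : ∀ i, B i ∈ 𝒜) : ⋂ i, B i ∈ 𝒜 := by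
  rw [← compl_compl (⋂ i, B i), Set.compl_iInter]
  exact h.compl_mem _ (h.iUnion_mem fun i => h.compl_mem _ (hB i))

theorem IsSigma.mem_borelClass (h : IsSigma κ τ α A) : A ∈ borelClass κ τ := by
  induction h with
  | of_isOpen U hU => exact mem_borelClass_of_isOpen hU
  | iUnion _ _ B _ _ _ _ ih =>
    exact isSuccAlgebra_borelClass.iUnion_mem fun i =>
      compl_compl (B i) ▸ isSuccAlgebra_borelClass.compl_mem _ (ih i)

theorem nonempty_toType_ord (hκ : ℵ₀ ≤ κ) : Nonempty κ.ord.ToType := by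
  rw [← mk_ne_zero_iff, mk_ord_toType]
  exact (aleph0_pos.trans_le hκ).ne'

theorem natCast_lt_ord_succ (hκ : ℵ₀ ≤ κ) (n : ℕ) : (n : Ordinal.{u}) < (Order.succ κ).ord := by
  rw [lt_ord, card_nat]
  exact natCast_lt_aleph0.trans_le (hκ.trans (Order.le_succ κ))

theorem IsSigma.compl (hκ : ℵ₀ ≤ κ) (h : IsSigma κ τ α A) (hαβ : α < β) :
    IsSigma κ τ β Aᶜ := by
  have := nonempty_toType_ord hκ
  exact (isSigma_iff (h.one_le.trans_lt hαβ)).2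
    ⟨fun _ => Aᶜ, fun _ => ⟨α, h.one_le, hαβ, by rwa [compl_compl]⟩, by rw [Set.iUnion_const]⟩

theorem IsSigma.mono_of_one_lt (h : IsSigma κ τ α A) (hα : 1 < α) (hαβ : α ≤ β) :
    IsSigma κ τ β A := by
  obtain ⟨B, hB, rfl⟩ := (isSigma_iff hα).1 h
  refine (isSigma_iff (hα.trans_le hαβ)).2 ⟨B, fun i => ?_, rfl⟩
  obtain ⟨γ, hγ, hγα, hBγ⟩ := hB i
  exact ⟨γ, hγ, hγα.trans_le hαβ, hBγ⟩

-- An open set reaches `Σ⁰_3` as the complement of its complement, which is in `Σ⁰_2`.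
theorem IsSigma.mono (hκ : ℵ₀ ≤ κ) (h : IsSigma κ τ α A) (hαβ : α < β)
    (hne : ¬ (α = 1 ∧ β = 2)) : IsSigma κ τ β A := by
  rcases h.one_le.eq_or_lt with rfl | hα
  · have hsucc : Order.succ (1 : Ordinal.{u}) = 2 := by
      rw [Order.succ_eq_add_one, one_add_one_eq_two]
    have hβ : (2 : Ordinal.{u}) < β :=
      (hsucc ▸ Order.succ_le_of_lt hαβ).lt_of_ne fun h => hne ⟨rfl, h.symm⟩
    have h12 : (1 : Ordinal.{u}) < 2 := hsucc ▸ Order.lt_succ 1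
    exact compl_compl A ▸ (h.compl hκ h12).compl hκ hβ
  · exact h.mono_of_one_lt hα hαβ.le

theorem isSigma_of_isClopen (hκ : ℵ₀ ≤ κ) (hα : 1 ≤ α) (hA : IsClopen A) : IsSigma κ τ α A := by
  rcases hα.eq_or_lt with rfl | hα
  · exact isSigma_one_iff.2 hA.isOpen
  · exact compl_compl A ▸ (isSigma_one_iff.2 hA.compl.isOpen).compl hκ hα

theorem IsSigma.compl_of_eq_ord_succ (hκ : ℵ₀ ≤ κ) (h : IsSigma κ τ (Order.succ κ).ord A) :
    IsSigma κ τ (Order.succ κ).ord Aᶜ := by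
  obtain ⟨B, hB, rfl⟩ := (isSigma_iff (mod_cast natCast_lt_ord_succ hκ 1)).1 h
  choose γ hγ hγκ hBγ using hB
  have hlimit : IsSuccLimit (Order.succ κ).ord := isSuccLimit_ord (hκ.trans (Order.le_succ κ))
  have hsup : (⨆ i, Order.succ (γ i)) < (Order.succ κ).ord := by
    refine Ordinal.iSup_lt_of_lt_cof ?_ fun i => hlimit.succ_lt (hγκ i)
    rw [(isRegular_succ hκ).cof_ord, mk_ord_toType]
    exact Order.lt_succ κ
  have hlt : ∀ i, γ i < ⨆ i, Order.succ (γ i) := fun i =>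
    Order.succ_le_iff.1 (Ordinal.le_iSup (fun i => Order.succ (γ i)) i)
  obtain ⟨i⟩ := nonempty_toType_ord hκ
  exact IsSigma.compl hκ ((isSigma_iff ((hγ i).trans_lt (hlt i))).2
    ⟨B, fun i => ⟨γ i, hγ i, hlt i, hBγ i⟩, rfl⟩) hsup

theorem exists_iUnion_eq_sUnion {𝒥 : Set (Set X)} (h𝒥 : #𝒥 ≤ κ)
    (hne : 𝒥.Nonempty) : ∃ B : κ.ord.ToType → Set X, (∀ i, B i ∈ 𝒥) ∧ ⋃₀ 𝒥 = ⋃ i, B i := by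
  have := hne.to_subtype
  obtain ⟨g⟩ : #𝒥 ≤ #κ.ord.ToType := h𝒥.trans (mk_ord_toType κ).ge
  let f : κ.ord.ToType → 𝒥 := Function.invFun g
  have hf : Function.Surjective f := Function.invFun_surjective g.injective
  refine ⟨fun i => f i, fun i => (f i).2, ?_⟩
  rw [Set.sUnion_eq_iUnion, hf.iUnion_comp fun A : 𝒥 => (A : Set X)]

theorem IsSigma.sUnion (hκ : ℵ₀ ≤ κ) (hα : 1 ≤ α) {𝒥 : Set (Set X)} (h𝒥 : 𝒥 ⊆ sigmaClass κ τ α)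
    (hcard : #𝒥 ≤ κ) : IsSigma κ τ α (⋃₀ 𝒥) := by
  rcases hα.eq_or_lt with rfl | hα
  · exact isSigma_one_iff.2 (isOpen_sUnion fun A hA => isSigma_one_iff.1 (h𝒥 hA))
  rcases 𝒥.eq_empty_or_nonempty with rfl | hne
  · rw [Set.sUnion_empty]
    exact isSigma_of_isClopen hκ hα.le isClopen_empty
  obtain ⟨B, hB, hunion⟩ := exists_iUnion_eq_sUnion hcard hne
  choose C hC hBC using fun i => (isSigma_iff hα).1 (h𝒥 (hB i))
  obtain ⟨e⟩ : Nonempty (κ.ord.ToType × κ.ord.ToType ≃ κ.ord.ToType) := Cardinal.eq.1 <| by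
    rw [mk_prod, Cardinal.lift_id, mk_ord_toType, mul_eq_self hκ]
  refine (isSigma_iff hα).2 ⟨fun i => C (e.symm i).1 (e.symm i).2, fun i => hC _ _, ?_⟩
  rw [hunion, e.symm.surjective.iUnion_comp fun p : κ.ord.ToType × κ.ord.ToType => C p.1 p.2,
    Set.iUnion_prod']
  exact Set.iUnion_congr hBC

theorem sigmaClass_ord_succ_eq_borelClass (hκ : ℵ₀ ≤ κ) :
    sigmaClass κ τ (Order.succ κ).ord = borelClass κ τ := by
  have h1 : 1 < (Order.succ κ).ord := mod_cast natCast_lt_ord_succ hκ 1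
  have h2 : 2 < (Order.succ κ).ord := mod_cast natCast_lt_ord_succ hκ 2
  refine Set.Subset.antisymm (fun A hA => IsSigma.mem_borelClass hA) fun A hA => hA _
    ⟨⟨fun A hA => IsSigma.compl_of_eq_ord_succ hκ hA, fun 𝒥 => IsSigma.sUnion hκ h1.le⟩,
      fun U hU => (isSigma_one_iff.2 hU).mono hκ h1 fun h => h2.ne' h.2⟩

theorem sigmaClass_eq_borelClass_of_subset (hκ : ℵ₀ ≤ κ) (hα : 1 ≤ α) (hαβ : α < β)
    (h : sigmaClass κ τ β ⊆ sigmaClass κ τ α) : sigmaClass κ τ α = borelClass κ τ := by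
  have hcompl : ∀ A, IsSigma κ τ α A → IsSigma κ τ α Aᶜ := fun A hA => h (hA.compl hκ hαβ)
  refine Set.Subset.antisymm (fun A hA => IsSigma.mem_borelClass hA) fun A hA => hA _
    ⟨⟨hcompl, fun 𝒥 => IsSigma.sUnion hκ hα⟩, fun U hU => ?_⟩
  exact compl_compl U ▸ hcompl _ (h ((isSigma_one_iff.2 hU).compl hκ (hα.trans_lt hαβ)))

theorem hasFullLength_of_not_collapses (hκ : ℵ₀ ≤ κ) (h : ¬ Collapses κ τ) :
    HasFullLength κ τ := by
  have hnot_subset : ∀ α β : Ordinal.{u}, 1 ≤ α → α < β → β < (Order.succ κ).ord →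
      ¬ sigmaClass κ τ β ⊆ sigmaClass κ τ α := fun α β hα hαβ hβ hsub =>
    h ⟨α, hα, hαβ.trans hβ, sigmaClass_eq_borelClass_of_subset hκ hα hαβ hsub⟩
  have hleast : ∀ α : Ordinal.{u}, 1 ≤ α ∧ sigmaClass κ τ α = borelClass κ τ →
      (Order.succ κ).ord ≤ α := fun α hα => not_lt.1 fun hlt => h ⟨α, hα.1, hlt, hα.2⟩
  exact ⟨⟨⟨mod_cast (natCast_lt_ord_succ hκ 1).le, sigmaClass_ord_succ_eq_borelClass hκ⟩, hleast⟩,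
    hnot_subset, fun α β hα hαβ hβ hne =>
      ⟨fun A hA => IsSigma.mono hκ hA hαβ hne, hnot_subset α β hα hαβ hβ⟩⟩

end Hierarchy

section UniversalOperation

variable {κ : Cardinal.{u}} {X : Type u} {τ : TopologicalSpace X} {α : Ordinal.{u}}

/-- The Boolean operation with truth table `T`: a point belongs to the result if the set of the
indices `j` with `x ∈ A j` is an entry of `T`. -/
def booleanOperation {ι : Type*} {X : Type*} (T : Set (Set ι)) (A : ι → Set X) : Set X :=
  {x | {j | x ∈ A j} ∈ T}

/-- The Boolean operation with truth table `T` yields every set of class `Σ⁰_α` when it is applied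
to `κ`-sequences of open sets, and it preserves `κ⁺`-Borel sets. -/
structure IsUniversalTable (κ : Cardinal.{u}) {X : Type u} (τ : TopologicalSpace X)
    (α : Ordinal.{u}) (T : Set (Set κ.ord.ToType)) : Prop where
  exists_isOpen : ∀ A, IsSigma κ τ α A →
    ∃ U : κ.ord.ToType → Set X, (∀ j, IsOpen[τ] (U j)) ∧ booleanOperation T U = A
  mem_borelClass : ∀ Z : κ.ord.ToType → Set X, (∀ j, Z j ∈ borelClass κ τ) →
    booleanOperation T Z ∈ borelClass κ τ

theorem isUniversalTable_one (hκ : ℵ₀ ≤ κ) :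
    IsUniversalTable κ τ 1 {S | S.Nonempty} := by
  have hunion : ∀ Z : κ.ord.ToType → Set X, booleanOperation {S | S.Nonempty} Z = ⋃ j, Z j :=
    fun Z => by
      ext x
      simp [booleanOperation, Set.Nonempty]
  have := nonempty_toType_ord hκ
  refine ⟨fun A hA => ⟨fun _ => A, fun _ => isSigma_one_iff.1 hA, ?_⟩, fun Z hZ => ?_⟩
  · rw [hunion, Set.iUnion_const]
  · rw [hunion]
    exact isSuccAlgebra_borelClass.iUnion_mem hZ

theorem exists_range_eq_Ico (h1 : 1 < α) (hα : α < (Order.succ κ).ord) :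
    ∃ b : κ.ord.ToType → Ordinal.{u}, Set.range b = Set.Ico 1 α := by
  have hcard : #α.ToType ≤ #κ.ord.ToType := by
    rw [mk_toType, mk_ord_toType, ← Order.lt_succ_iff, ← lt_ord]
    exact hα
  obtain ⟨g⟩ := hcard
  have : Nonempty α.ToType := ⟨ToType.mk ⟨1, h1⟩⟩
  have hg := Function.invFun_surjective g.injective
  refine ⟨fun i => max 1 (ToType.mk.symm (Function.invFun g i)).1, Set.Subset.antisymm ?_ ?_⟩
  · rintro _ ⟨i, rfl⟩
    exact ⟨le_max_left _ _, max_lt h1 (ToType.mk.symm _).2⟩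
  · rintro β ⟨hβ, hβα⟩
    obtain ⟨i, hi⟩ := hg (ToType.mk ⟨β, hβα⟩)
    exact ⟨i, by simp [hi, hβ]⟩

theorem IsSigma.exists_iUnion_compl (hκ : ℵ₀ ≤ κ) (hα : 1 < α) {b : κ.ord.ToType → Ordinal.{u}}
    (hb : Set.range b = Set.Ico 1 α) {A : Set X} (h : IsSigma κ τ α A) :
    ∃ C : κ.ord.ToType → κ.ord.ToType → Set X,
      (∀ m n, IsSigma κ τ (b m) (C m n)) ∧ A = ⋃ m, ⋃ n, (C m n)ᶜ := by
  classical
  obtain ⟨B, hB, rfl⟩ := (isSigma_iff hα).1 h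
  choose γ hγ hγα hBγ using hB
  refine ⟨fun m n => if b m = γ n then (B n)ᶜ else Set.univ, fun m n => ?_, ?_⟩
  · dsimp only
    split_ifs with hm
    · exact hm ▸ hBγ n
    · exact isSigma_of_isClopen hκ (hb ▸ Set.mem_range_self m : b m ∈ Set.Ico 1 α).1 isClopen_univ
  · rw [Set.iUnion_comm]
    refine Set.iUnion_congr fun n => ?_
    obtain ⟨m, hm⟩ : γ n ∈ Set.range b := hb ▸ ⟨hγ n, hγα n⟩
    refine Set.Subset.antisymm (Set.subset_iUnion_of_subset m (by simp [hm])) ?_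
    refine Set.iUnion_subset fun m' => ?_
    dsimp only
    split_ifs <;> simp

theorem isUniversalTable_of_range_eq_Ico (hκ : ℵ₀ ≤ κ) (hα : 1 < α)
    {b : κ.ord.ToType → Ordinal.{u}} (hb : Set.range b = Set.Ico 1 α)
    {T : κ.ord.ToType → Set (Set κ.ord.ToType)} (hT : ∀ m, IsUniversalTable κ τ (b m) (T m))
    (e : κ.ord.ToType × κ.ord.ToType × κ.ord.ToType ≃ κ.ord.ToType) :
    IsUniversalTable κ τ α {S | ∃ m n, {j | e (m, n, j) ∈ S} ∉ T m} := by
  have hunion : ∀ Z : κ.ord.ToType → Set X,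
      booleanOperation {S | ∃ m n, {j | e (m, n, j) ∈ S} ∉ T m} Z =
        ⋃ m, ⋃ n, (booleanOperation (T m) fun j => Z (e (m, n, j)))ᶜ := fun Z => by
    ext x
    simp [booleanOperation]
  refine ⟨fun A hA => ?_, fun Z hZ => ?_⟩
  · obtain ⟨C, hC, rfl⟩ := hA.exists_iUnion_compl hκ hα hb
    choose V hV hVC using fun m n => (hT m).exists_isOpen _ (hC m n)
    refine ⟨fun i => V (e.symm i).1 (e.symm i).2.1 (e.symm i).2.2, fun i => hV _ _ _, ?_⟩
    simp only [hunion, Equiv.symm_apply_apply, hVC]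
  · rw [hunion]
    exact isSuccAlgebra_borelClass.iUnion_mem fun m => isSuccAlgebra_borelClass.iUnion_mem fun n =>
      isSuccAlgebra_borelClass.compl_mem _ ((hT m).mem_borelClass _ fun j => hZ _)

theorem exists_isUniversalTable (hκ : ℵ₀ ≤ κ) (h1 : 1 ≤ α) (hα : α < (Order.succ κ).ord) :
    ∃ T, IsUniversalTable κ τ α T := by
  induction α using WellFoundedLT.induction with
  | ind α ih =>
    rcases h1.eq_or_lt with rfl | h1
    · exact ⟨_, isUniversalTable_one hκ⟩
    obtain ⟨b, hb⟩ := exists_range_eq_Ico h1 hα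
    have hmem : ∀ m, b m ∈ Set.Ico 1 α := fun m => hb ▸ Set.mem_range_self m
    choose T hT using fun m => ih (b m) (hmem m).2 (hmem m).1 ((hmem m).2.trans hα)
    obtain ⟨e⟩ : Nonempty (κ.ord.ToType × κ.ord.ToType × κ.ord.ToType ≃ κ.ord.ToType) :=
      Cardinal.eq.1 <| by simp only [mk_prod, Cardinal.lift_id, mk_ord_toType, mul_eq_self hκ]
    exact ⟨_, isUniversalTable_of_range_eq_Ico hκ h1 hb hT e⟩

theorem not_collapses_of_forall_exists_mem_iff (hκ : ℵ₀ ≤ κ) {Z : κ.ord.ToType → Set X}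
    (hZ : ∀ j, Z j ∈ borelClass κ τ)
    (h : ∀ U : κ.ord.ToType → Set X, (∀ j, IsOpen[τ] (U j)) → ∃ x, ∀ j, x ∈ U j ↔ x ∈ Z j) :
    ¬ Collapses κ τ := by
  rintro ⟨α, h1, hα, hcollapse⟩
  obtain ⟨T, hT⟩ := exists_isUniversalTable (τ := τ) hκ h1 hα
  have hdiag : (booleanOperation T Z)ᶜ ∈ sigmaClass κ τ α :=
    hcollapse ▸ isSuccAlgebra_borelClass.compl_mem _ (hT.mem_borelClass Z hZ)
  obtain ⟨U, hU, hUZ⟩ := hT.exists_isOpen _ hdiag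
  obtain ⟨x, hx⟩ := h U hU
  have hmem : x ∈ booleanOperation T U ↔ x ∈ booleanOperation T Z := by
    simp only [booleanOperation, Set.mem_ofPred_eq, hx]
  rw [hUZ] at hmem
  exact iff_not_self hmem.symm

end UniversalOperation

section Choice

theorem exists_forall_rel_of_wellFoundedLT {K : Type u} [LinearOrder K] [WellFoundedLT K]
    {T : Type v} [Inhabited T] (R : K → (K → T) → T → Prop)
    (hR : ∀ k s s' t, (∀ l < k, s l = s' l) → R k s t → R k s' t)
    (hex : ∀ k s, (∀ l < k, R l s (s l)) → ∃ t, R k s t) : ∃ s : K → T, ∀ k, R k s (s k) := by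
  classical
  let F : (k : K) → (∀ l < k, T) → T := fun k prev =>
    Classical.epsilon (R k fun l => if h : l < k then prev l h else default)
  let s : K → T := (wellFounded_lt (α := K)).fix F
  have hs (k : K) : s k = Classical.epsilon (R k fun l => if l < k then s l else default) := by
    simpa only [F, dite_eq_ite] using (wellFounded_lt (α := K)).fix_eq F k
  refine ⟨s, fun k => ?_⟩
  induction k using WellFoundedLT.induction with
  | ind k ih =>
    have hagree : ∀ l < k, s l = if l < k then s l else default := fun l hl => (if_pos hl).symm
    obtain ⟨t, ht⟩ := hex k s ih
    have hk := Classical.epsilon_spec ⟨t, hR _ _ _ _ hagree ht⟩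
    rw [← hs k] at hk
    exact hR _ _ _ _ (fun l hl => (hagree l hl).symm) hk

theorem exists_injective_choice {S T : Type u} (F : T → Set S) (hF : ∀ t, #T ≤ #(F t)) :
    ∃ c : T → S, Function.Injective c ∧ ∀ t, c t ∈ F t := by
  classical
  rcases isEmpty_or_nonempty T with h | ⟨⟨t₀⟩⟩
  · exact ⟨h.elim, fun t => h.elim t, h.elim⟩
  obtain ⟨e⟩ : Nonempty ((#T).ord.ToType ≃ T) := Cardinal.eq.1 (mk_ord_toType _)
  have hne : Nonempty (F t₀) := mk_ne_zero_iff.1 <|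
    ((pos_iff_ne_zero.2 (mk_ne_zero_iff.2 ⟨t₀⟩)).trans_le (hF t₀)).ne'
  have : Inhabited S := ⟨hne.some⟩
  obtain ⟨s, hs⟩ := exists_forall_rel_of_wellFoundedLT
    (fun k (s : (#T).ord.ToType → S) x => x ∈ F (e k) ∧ ∀ l < k, s l ≠ x)
    (fun k s s' x h h' => ⟨h'.1, fun l hl => h l hl ▸ h'.2 l hl⟩) fun k s _ => by
      by_contra! hcon
      have hlt : #(s '' Set.Iio k) < #(F (e k)) :=
        (mk_image_le.trans_lt (mk_Iio_lt k (by simp))).trans_le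
          ((mk_ord_toType _).trans_le (hF (e k)))
      exact hlt.not_ge (mk_le_mk_of_subset hcon)
  have hinj : Function.Injective s := fun k l hkl => by
    rcases lt_trichotomy k l with h | h | h
    · exact ((hs l).2 k h hkl).elim
    · exact h
    · exact ((hs k).2 l h hkl.symm).elim
  exact ⟨s ∘ e.symm, hinj.comp e.symm.injective, fun t => by simpa using (hs (e.symm t)).1⟩

end Choice

section RegularOrder

variable {L : Type u} [LinearOrder L] [WellFoundedLT L]

instance noMaxOrder_of_isRegularCardinalOrder [IsRegularCardinalOrder L] [Infinite L] :
    NoMaxOrder L := by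
  have hL : 1 < #L := one_lt_aleph0.trans_le (aleph0_le_mk L)
  exact (noTopOrder_iff_noMaxOrder L).1 (cof_ne_one_iff.1 (cof_eq_cardinalMk.trans_ne hL.ne'))

theorem bddAbove_of_mk_lt [IsRegularCardinalOrder L] {S : Set L} (hS : #S < #L) : BddAbove S :=
  .of_not_isCofinal fun h => (cof_le h).not_gt (cof_eq_cardinalMk (α := L) ▸ hS)

theorem mk_Iic_lt [IsRegularCardinalOrder L] [Infinite L] (i : L) : #(Set.Iic i) < #L := by
  obtain ⟨j, hij⟩ := exists_gt i
  exact (mk_le_mk_of_subset (Set.Iic_subset_Iio.2 hij)).trans_lt (mk_Iio_lt j ord_cardinalMk)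

theorem mk_eq_of_not_bddAbove [IsRegularCardinalOrder L] {S : Set L} (hS : ¬ BddAbove S) :
    #S = #L :=
  (mk_set_le S).antisymm (not_lt.1 fun h => hS (bddAbove_of_mk_lt h))

theorem bddAbove_image_of_mk_lt [IsRegularCardinalOrder L] {ι : Type u} {S : Set ι} (hS : #S < #L)
    (f : ι → L) : BddAbove (f '' S) :=
  bddAbove_of_mk_lt (mk_image_le.trans_lt hS)

theorem isRegularCardinalOrder_of_forall_mk_Iio_lt (h : ∀ i : L, #(Set.Iio i) < cof L) :
    IsRegularCardinalOrder L where
  type_lt_le_ord_cof := le_of_forall_lt fun o ho => by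
    obtain ⟨i, rfl⟩ := Ordinal.mem_range_typein_iff (· < ·) |>.2 ho
    rw [lt_ord, Ordinal.card_typein]
    exact h i

theorem exists_isLUB_of_bddAbove {S : Set L} (hS : BddAbove S) : ∃ a, IsLUB S a := by
  obtain ⟨a, ha, hmin⟩ := wellFounded_lt.has_min _ hS
  exact ⟨a, ha, fun b hb => not_lt.1 (hmin b hb)⟩

/-- The points of a linear order that are closed under the function `f`. A bottom element, which is
vacuously closed, is left out. -/
def closurePts {L : Type*} [LinearOrder L] (f : L → L) : Set L :=
  {δ | (Set.Iio δ).Nonempty ∧ Set.MapsTo f (Set.Iio δ) (Set.Iio δ)}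

theorem isClub_closurePts [IsRegularCardinalOrder L] [Uncountable L] (f : L → L) :
    IsClub (closurePts f) := by
  refine ⟨fun D hD ⟨δ, hδ⟩ _ a ha => ⟨(hD hδ).1.mono (Set.Iio_subset_Iio (ha.1 hδ)),
    fun η hη => ?_⟩, fun a => ?_⟩
  · obtain ⟨δ, hδ, hηδ⟩ := (lt_isLUB_iff ha).1 hη
    exact ((hD hδ).2 hηδ).trans_le (ha.1 hδ)
  have hnext : ∀ b : L, ∃ c, b < c ∧ ∀ η ≤ b, f η < c := fun b => by
    obtain ⟨c, hc⟩ := bddAbove_image_of_mk_lt (mk_Iic_lt b) f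
    obtain ⟨d, hd⟩ := exists_gt (max b c)
    exact ⟨d, (le_max_left _ _).trans_lt hd,
      fun η hη => (hc ⟨η, hη, rfl⟩).trans_lt ((le_max_right _ _).trans_lt hd)⟩
  choose next hlt hf using hnext
  have hbdd : BddAbove (Set.range fun n => next^[n] a) := bddAbove_of_mk_lt <|
    (Set.countable_range _).le_aleph0.trans_lt aleph0_lt_mk
  obtain ⟨δ, hδ⟩ := exists_isLUB_of_bddAbove hbdd
  have hsucc : ∀ n, next^[n] a < next^[n + 1] a := fun n => by
    rw [Function.iterate_succ_apply']
    exact hlt _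
  have hlt' : ∀ n, next^[n] a < δ := fun n => (hsucc n).trans_le (hδ.1 ⟨n + 1, rfl⟩)
  refine ⟨δ, ⟨⟨a, hlt' 0⟩, fun η hη => ?_⟩, (hlt' 0).le⟩
  obtain ⟨_, ⟨n, rfl⟩, hn⟩ := (lt_isLUB_iff hδ).1 hη
  have := hf _ η hn.le
  rw [← Function.iterate_succ_apply' next] at this
  exact this.trans (hlt' (n + 1))

theorem exists_closurePts_subset_of_isClub {L : Type*} [LinearOrder L] [NoMaxOrder L] {C : Set L}
    (hC : IsClub C) : ∃ f : L → L, closurePts f ⊆ C := by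
  have hnext : ∀ b : L, ∃ c ∈ C, b < c := fun b => by
    obtain ⟨c, hbc⟩ := exists_gt b
    obtain ⟨d, hd, hcd⟩ := hC.isCofinal c
    exact ⟨d, hd, hbc.trans_le hcd⟩
  choose f hfC hlt using hnext
  refine ⟨f, fun δ ⟨⟨η, hη⟩, hδ⟩ => hC.isLUB_mem (t := f '' Set.Iio δ) ?_ ⟨_, η, hη, rfl⟩ ?_⟩
  · exact Set.image_subset_iff.2 fun η _ => hfC η
  · exact ⟨by rintro _ ⟨η, hη, rfl⟩; exact (hδ hη).le,
      fun b hb => le_of_forall_lt fun η hη => (hlt η).trans_le (hb ⟨η, hη, rfl⟩)⟩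

theorem isStationary_iff_forall_closurePts [IsRegularCardinalOrder L] [Uncountable L] {S : Set L} :
    IsStationary S ↔ ∀ f : L → L, (S ∩ closurePts f).Nonempty := by
  refine ⟨fun h f => h (isClub_closurePts f), fun h C hC => ?_⟩
  obtain ⟨f, hf⟩ := exists_closurePts_subset_of_isClub hC
  exact (h f).mono (Set.inter_subset_inter_right S hf)

theorem isStationary_or_of_union [IsRegularCardinalOrder L] [Uncountable L] {S T : Set L}
    (h : IsStationary (S ∪ T)) : IsStationary S ∨ IsStationary T :=
  (isStationary_union_iff (cof_eq_cardinalMk.trans_ne aleph0_lt_mk.ne')).1 h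

theorem not_bddAbove_of_isStationary [IsRegularCardinalOrder L] [Uncountable L] {S : Set L}
    (hS : IsStationary S) : ¬ BddAbove S := by
  rintro ⟨η, hη⟩
  obtain ⟨δ, hδ, ⟨η', hη'⟩, hδη⟩ := isStationary_iff_forall_closurePts.1 hS fun _ => η
  exact (hη hδ).not_gt (hδη hη')

theorem isStationary_of_eventuallyEq [IsRegularCardinalOrder L] [Uncountable L] {S T : Set L}
    (hS : IsStationary S) (hST : S =ᶠ[atTop] T) : IsStationary T := by
  obtain ⟨η, hη⟩ := eventually_atTop.1 (eventuallyEq_set.1 hST)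
  refine isStationary_iff_forall_closurePts.2 fun f => ?_
  obtain ⟨δ, hδS, hne, hδ⟩ := isStationary_iff_forall_closurePts.1 hS fun l => max (f l) η
  obtain ⟨l, hl⟩ := hne
  exact ⟨δ, (hη δ ((le_max_right _ _).trans (hδ hl).le)).1 hδS, ⟨l, hl⟩,
    fun l hl => (le_max_left _ _).trans_lt (hδ hl)⟩

theorem exists_pairwiseDisjoint_isStationary_diff [IsRegularCardinalOrder L] [Uncountable L]
    {R : Set L} (hR : IsStationary R) : ∃ P : L → Set L, (∀ γ, P γ ⊆ R ∧ ¬ BddAbove (P γ)) ∧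
      Pairwise (Function.onFun Disjoint P) ∧ IsStationary (R \ ⋃ γ, P γ) := by
  have hL : #L * #L = #L := mul_eq_self (aleph0_le_mk L)
  have hL2 : #L * 2 = #L := mul_eq_left (aleph0_le_mk L) (ofNat_le_aleph0.trans (aleph0_le_mk L))
    two_ne_zero
  have hRL := mk_eq_of_not_bddAbove (not_bddAbove_of_isStationary hR)
  obtain ⟨e⟩ : Nonempty ((L × L) × Bool ≃ R) := Cardinal.eq.1 <| by
    simp [hRL, hL, hL2]
  let P : Bool → L → Set L := fun b γ => Set.range fun ζ => (e ((γ, ζ), b) : L)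
  have hunb : ∀ b γ, ¬ BddAbove (P b γ) := fun b γ ⟨η, hη⟩ => (mk_Iic_lt η).not_ge <|
    mk_le_of_injective (f := fun ζ => (⟨e ((γ, ζ), b), hη ⟨ζ, rfl⟩⟩ : Set.Iic η)) fun ζ ζ' h => by
      simpa using e.injective (Subtype.ext (Subtype.mk.inj h))
  have hdisj : ∀ b, Pairwise (Function.onFun Disjoint (P b)) := fun b γ γ' hne =>
    Set.disjoint_left.2 fun δ ⟨ζ, hζ⟩ ⟨ζ', hζ'⟩ => hne <| by
      have := e.injective (Subtype.ext (hζ.trans hζ'.symm))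
      simp_all
  -- No point lies both in some `P true γ` and in some `P false γ'`.
  have hcover : R ⊆ (R \ ⋃ γ, P true γ) ∪ (R \ ⋃ γ, P false γ) := fun δ hδ => by
    by_contra hcon
    simp only [Set.mem_union, Set.mem_sdiff, hδ, true_and, not_or, not_not, Set.mem_iUnion] at hcon
    obtain ⟨⟨γ, ζ, hζ⟩, γ', ζ', hζ'⟩ := hcon
    have := e.injective (Subtype.ext (hζ.trans hζ'.symm))
    simp at this
  have hsub : ∀ b γ, P b γ ⊆ R := fun b γ => Set.range_subset_iff.2 fun ζ => (e _).2
  rcases isStationary_or_of_union (hR.mono hcover) with h | h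
  · exact ⟨P true, fun γ => ⟨hsub _ γ, hunb _ γ⟩, hdisj _, h⟩
  · exact ⟨P false, fun γ => ⟨hsub _ γ, hunb _ γ⟩, hdisj _, h⟩

theorem exists_isStationary_subset_family [IsRegularCardinalOrder L] [Uncountable L] {R G : Set L}
    (hR : IsStationary R) (hG : Disjoint G R) : ∃ r : Set L → Set L,
      (∀ w, r w ⊆ R ∧ IsStationary (r w)) ∧
      ∀ w w', (G ∪ r w : Set L) =ᶠ[atTop] (G ∪ r w' : Set L) → w ⊆ w' := by
  obtain ⟨P, hP, hdisj, hst⟩ := exists_pairwiseDisjoint_isStationary_diff hR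
  refine ⟨fun w => R \ ⋃ γ ∈ w, P γ, fun w => ⟨Set.sdiff_subset, hst.mono ?_⟩,
    fun w w' h γ hγ => ?_⟩
  · exact Set.sdiff_subset_sdiff_right (Set.iUnion₂_subset_iUnion _ _)
  obtain ⟨η, hη⟩ := eventually_atTop.1 (eventuallyEq_set.1 h)
  obtain ⟨δ, hδ, hηδ⟩ := not_bddAbove_iff.1 (hP γ).2 η
  have hδR := (hP γ).1 hδ
  have hδG : δ ∉ G := fun h => Set.disjoint_left.1 hG h hδR
  have hδw : δ ∉ R \ ⋃ γ ∈ w, P γ := fun h => h.2 (Set.mem_biUnion hγ hδ)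
  have hδw' : δ ∉ R \ ⋃ γ ∈ w', P γ := fun h =>
    ((hη δ hηδ.le).2 (Or.inr h)).elim hδG hδw
  obtain ⟨γ', hγ', hδ'⟩ : ∃ γ' ∈ w', δ ∈ P γ' := by simpa [hδR] using hδw'
  by_contra hcon
  exact Set.disjoint_left.1 (hdisj (i := γ) (j := γ') fun h => hcon (h ▸ hγ')) hδ hδ'

/-- Equality of subsets of a linear order up to a bounded set. -/
def tailSetoid (L : Type*) [LinearOrder L] : Setoid (Set L) where
  r S T := S =ᶠ[atTop] T
  iseqv := ⟨fun _ => .rfl, .symm, .trans⟩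

theorem exists_labelling [IsRegularCardinalOrder L] [Uncountable L] {Λ : Type u}
    (hΛ : #Λ ≤ #(Set L)) : ∃ ℓ : Set L → Option Λ, (∀ S T : Set L, S =ᶠ[atTop] T → ℓ S = ℓ T) ∧
      ∀ R G, IsStationary R → Disjoint G R → ∀ v,
        ∃ R' ⊆ R, IsStationary R' ∧ ℓ (G ∪ R') = some v := by
  classical
  let T := {t : Set L × Set L × Λ // IsStationary t.1 ∧ Disjoint t.2.1 t.1}
  have hT : #T ≤ #(Set L) := by
    have hinf : ℵ₀ ≤ #(Set L) := aleph0_le_mk _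
    refine (mk_subtype_le _).trans ?_
    simp only [mk_prod, Cardinal.lift_id]
    exact mul_le_of_le hinf le_rfl (mul_le_of_le hinf le_rfl hΛ)
  let q : Set L → Quotient (tailSetoid L) := Quotient.mk _
  -- Thinning out a given `R` produces `#(Set L)` many germs, and there are no more than `#(Set L)`
  -- requirements `(R, G, v)`, so that each of them gets a germ of its own.
  obtain ⟨c, hc, hcF⟩ := exists_injective_choice (T := T)
    (fun t => {x | ∃ R' ⊆ t.1.1, IsStationary R' ∧ q (t.1.2.1 ∪ R') = x}) fun t => by
      obtain ⟨r, hr, hrw⟩ := exists_isStationary_subset_family t.2.1 t.2.2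
      refine hT.trans (mk_le_of_injective
        (f := fun w => ⟨q (t.1.2.1 ∪ r w), r w, (hr w).1, (hr w).2, rfl⟩) fun w w' h => ?_)
      have h : (t.1.2.1 ∪ r w : Set L) =ᶠ[atTop] (t.1.2.1 ∪ r w' : Set L) :=
        Quotient.exact (Subtype.mk.inj h)
      exact (hrw _ _ h).antisymm (hrw _ _ h.symm)
  refine ⟨fun S => (Function.partialInv c (q S)).map fun t => t.1.2.2, fun S S' h => ?_,
    fun R G hR hGR v => ?_⟩
  · have hq : q S = q S' := Quotient.sound h
    simp only [hq]
  · obtain ⟨R', hR'R, hR', hq⟩ := hcF ⟨(R, G, v), hR, hGR⟩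
    exact ⟨R', hR'R, hR', by simp only [hq, Function.partialInv_left hc, Option.map_some]⟩

end RegularOrder

section Saturated

variable {K : Type u} {l : Filter K}

/-- A filter on `K` is saturated if there is no partition of `K` into `#K` many positive sets. -/
def IsSaturated (l : Filter K) : Prop := ∀ f : K → K, ∃ k, ∀ᶠ ξ in l, f ξ ≠ k

theorem IsSaturated.mono {l' : Filter K} (h : IsSaturated l) (hle : l' ≤ l) : IsSaturated l' :=
  fun f => (h f).imp fun _ hk => hk.filter_mono hle

theorem exists_frequently_eq_of_not_isSaturated [Infinite K] (h : ¬ IsSaturated l) :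
    ∃ f : K → K × Bool, ∀ v, ∃ᶠ i in l, f i = v := by
  simp only [IsSaturated, not_forall, not_exists] at h
  obtain ⟨f, hf⟩ := h
  obtain ⟨e⟩ : Nonempty (K ≃ K × Bool) := Cardinal.eq.1 <| by
    have hK := aleph0_le_mk K
    rw [mk_prod, Cardinal.lift_uzero, mk_bool, Cardinal.lift_ofNat,
      mul_eq_left hK (ofNat_le_aleph0.trans hK) two_ne_zero]
  exact ⟨e ∘ f, fun v hv => hf (e.symm v) (hv.mono fun _ hne h => hne (e.eq_symm_apply.1 h))⟩

theorem IsSaturated.mk_lt (hl : IsSaturated l) {𝓕 : Set (Set K)}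
    (hpos : ∀ B ∈ 𝓕, ∃ᶠ ξ in l, ξ ∈ B) (hdisj : 𝓕.PairwiseDisjoint id) : #𝓕 < #K := by
  classical
  by_contra h
  obtain ⟨c⟩ := not_lt.1 h
  have hinj : ∀ {k m ξ}, ξ ∈ (c k : Set K) → ξ ∈ (c m : Set K) → k = m := fun hk hm =>
    c.injective (Subtype.ext (hdisj.elim_set (c _).2 (c _).2 _ hk hm))
  obtain ⟨k, hk⟩ := hl fun ξ => if h : ∃ k, ξ ∈ (c k : Set K) then h.choose else ξ
  refine hpos _ (c k).2 (hk.mono fun ξ hξ hξk => hξ ?_)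
  have hex : ∃ k, ξ ∈ (c k : Set K) := ⟨k, hξk⟩
  rw [dif_pos hex]
  exact hinj hex.choose_spec hξk

theorem IsSaturated.exists_subset_sUnion_mem (hl : IsSaturated l) {𝒢 : Set (Set K)}
    (hpos : ∀ B ∈ 𝒢, ∃ᶠ ξ in l, ξ ∈ B)
    (hdense : ∀ A : Set K, (∃ᶠ ξ in l, ξ ∈ A) → ∃ B ∈ 𝒢, B ⊆ A) :
    ∃ 𝓕 ⊆ 𝒢, #𝓕 < #K ∧ ⋃₀ 𝓕 ∈ l := by
  obtain ⟨𝓕, h𝓕⟩ := zorn_subset {𝓕 : Set (Set K) | 𝓕 ⊆ 𝒢 ∧ 𝓕.PairwiseDisjoint id}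
    fun c hc hchain => ⟨⋃₀ c, ⟨Set.sUnion_subset fun 𝓕 h𝓕 => (hc h𝓕).1,
      (Set.pairwise_sUnion hchain.directedOn).2 fun 𝓕 h𝓕 => (hc h𝓕).2⟩,
      fun s hs => Set.subset_sUnion_of_mem hs⟩
  obtain ⟨hsub, hdisj⟩ := h𝓕.prop
  refine ⟨𝓕, hsub, hl.mk_lt (fun B hB => hpos B (hsub hB)) hdisj, ?_⟩
  by_contra hcon
  obtain ⟨B, hB, hBA⟩ := hdense (⋃₀ 𝓕)ᶜ fun h => hcon (h.mono fun ξ => not_not.1)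
  have hBdisj : ∀ C ∈ 𝓕, Disjoint B C := fun C hC =>
    (disjoint_compl_left.mono_left hBA).mono_right (Set.subset_sUnion_of_mem hC)
  have hmem : B ∈ 𝓕 := h𝓕.le_of_ge
    ⟨Set.insert_subset hB hsub, hdisj.insert fun C hC _ => hBdisj C hC⟩
    (Set.subset_insert _ _) (Set.mem_insert _ _)
  obtain ⟨ξ, hξ⟩ := (hpos B hB).exists
  exact Set.disjoint_left.1 (hBdisj B hmem) hξ hξ

variable [LinearOrder K] {g : K → K}

/-- `g` is a least unbounded function modulo `l`: it tends to infinity along `l`, and no function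
that is smaller than `g` on a positive set does so on that set. -/
structure IsLeastUnbounded (l : Filter K) (g : K → K) : Prop where
  tendsto : Tendsto g l atTop
  not_tendsto : ∀ B : Set K, (∃ᶠ ξ in l, ξ ∈ B) → ∀ h : K → K, (∀ ξ ∈ B, h ξ < g ξ) →
    ¬ Tendsto h (l ⊓ 𝓟 B) atTop

theorem IsSaturated.exists_tendsto_lt [CardinalInterFilter l #K] (hl : IsSaturated l)
    (hg : ∀ A : Set K, (∃ᶠ ξ in l, ξ ∈ A) → ∃ B ⊆ A, (∃ᶠ ξ in l, ξ ∈ B) ∧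
      ∃ h : K → K, (∀ ξ ∈ B, h ξ < g ξ) ∧ Tendsto h (l ⊓ 𝓟 B) atTop) :
    ∃ h : K → K, Tendsto h l atTop ∧ ∀ᶠ ξ in l, h ξ < g ξ := by
  classical
  obtain ⟨𝓕, h𝓕, hcard, hmem⟩ := hl.exists_subset_sUnion_mem (𝒢 := {B | (∃ᶠ ξ in l, ξ ∈ B) ∧
      ∃ h : K → K, (∀ ξ ∈ B, h ξ < g ξ) ∧ Tendsto h (l ⊓ 𝓟 B) atTop}) (fun B hB => hB.1)
    fun A hA => by
      obtain ⟨B, hBA, hB⟩ := hg A hA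
      exact ⟨B, hB, hBA⟩
  choose h hlt htend using fun B : 𝓕 => (h𝓕 B.2).2
  have hpiece : ∀ ξ, ∃ b, ξ ∈ ⋃₀ 𝓕 → ∃ B : 𝓕, ξ ∈ (B : Set K) ∧ b = h B ξ := fun ξ => by
    by_cases hξ : ξ ∈ ⋃₀ 𝓕
    · obtain ⟨B, hB, hξB⟩ := hξ
      exact ⟨h ⟨B, hB⟩ ξ, fun _ => ⟨⟨B, hB⟩, hξB, rfl⟩⟩
    · exact ⟨ξ, fun h => (hξ h).elim⟩
  choose h' hh' using hpiece
  refine ⟨h', tendsto_atTop.2 fun b => ?_, ?_⟩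
  · have hb : ∀ᶠ ξ in l, ∀ B : 𝓕, ξ ∈ (B : Set K) → b ≤ h B ξ :=
      (eventually_cardinal_forall hcard).2 fun B =>
        eventually_inf_principal.1 (tendsto_atTop.1 (htend B) b)
    filter_upwards [hmem, hb] with ξ hξ hξb
    obtain ⟨B, hξB, hB⟩ := hh' ξ hξ
    exact hB ▸ hξb B hξB
  · filter_upwards [hmem] with ξ hξ
    obtain ⟨B, hξB, hB⟩ := hh' ξ hξ
    exact hB ▸ hlt B ξ hξB

theorem IsSaturated.exists_isLeastUnbounded [WellFoundedLT K] [Uncountable K] [l.NeBot]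
    [CardinalInterFilter l #K]
    (hl : IsSaturated l) (hatTop : l ≤ atTop) : ∃ A : Set K, (∃ᶠ ξ in l, ξ ∈ A) ∧
      ∃ g : K → K, Tendsto g l atTop ∧ IsLeastUnbounded (l ⊓ 𝓟 A) g := by
  by_contra! hcon
  have hstep : ∀ g : {g : K → K // Tendsto g l atTop}, ∃ h : {h : K → K // Tendsto h l atTop},
      ∀ᶠ ξ in l, h.1 ξ < g.1 ξ := by
    rintro ⟨g, hg⟩
    obtain ⟨h, hh, hlt⟩ := hl.exists_tendsto_lt (g := g) fun A hA => by
      by_contra! hA'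
      refine hcon A hA g hg ⟨hg.mono_left inf_le_left, fun B hB h hlt htend => ?_⟩
      rw [frequently_inf_principal] at hB
      refine hA' (A ∩ B) Set.inter_subset_left hB h (fun ξ hξ => hlt ξ hξ.2) ?_
      rwa [← inf_principal, ← inf_assoc]
    exact ⟨⟨h, hh⟩, hlt⟩
  choose next hnext using hstep
  let G : ℕ → {g : K → K // Tendsto g l atTop} := fun n => next^[n] ⟨id, hatTop⟩
  have := CardinalInterFilter.toCountableInterFilter l (aleph0_lt_mk (α := K))
  have hdesc : ∀ᶠ ξ in l, ∀ n, (G (n + 1)).1 ξ < (G n).1 ξ := by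
    refine eventually_countable_forall.2 fun n => ?_
    simpa only [G, Function.iterate_succ_apply'] using hnext (G n)
  obtain ⟨ξ, hξ⟩ := hdesc.exists
  obtain ⟨n, hn⟩ := WellFounded.not_rel_apply_succ (r := (· < · : K → K → Prop)) fun n => (G n).1 ξ
  exact hn (hξ n)

namespace IsLeastUnbounded

variable [WellFoundedLT K] [IsRegularCardinalOrder K]

theorem exists_bound (hg : IsLeastUnbounded l g) (hl : IsSaturated l) (h : K → K) :
    ∃ b, ∀ᶠ ξ in l, h ξ < g ξ → h ξ ≤ b := by
  obtain ⟨𝓕, h𝓕, hcard, hmem⟩ := hl.exists_subset_sUnion_mem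
    (𝒢 := {B | (∃ᶠ ξ in l, ξ ∈ B) ∧ ∃ b, ∀ ξ ∈ B, h ξ < g ξ → h ξ ≤ b}) (fun B hB => hB.1)
    fun A hA => by
      by_cases hpos : ∃ᶠ ξ in l, ξ ∈ A ∩ {ξ | h ξ < g ξ}
      · obtain ⟨b, hb⟩ := not_forall.1 <| mt tendsto_atTop.2 <|
          hg.not_tendsto _ hpos h fun ξ hξ => hξ.2
        exact ⟨_, ⟨frequently_inf_principal.1 (not_eventually.1 hb), b,
          fun ξ hξ _ => (not_le.1 hξ.2).le⟩, fun ξ hξ => hξ.1.1⟩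
      · have hlarge : ∃ᶠ ξ in l, ξ ∈ A ∩ {ξ | ¬ h ξ < g ξ} :=
          (hA.and_eventually (not_frequently.1 hpos)).mono fun ξ hξ =>
            ⟨hξ.1, fun h => hξ.2 ⟨hξ.1, h⟩⟩
        obtain ⟨b, -⟩ := hA.exists
        exact ⟨_, ⟨hlarge, b, fun ξ hξ h => (hξ.2 h).elim⟩, Set.inter_subset_left⟩
  choose b hb using fun B : 𝓕 => (h𝓕 B.2).2
  obtain ⟨c, hc⟩ := bddAbove_of_mk_lt (mk_range_le.trans_lt hcard : #(Set.range b) < #K)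
  refine ⟨c, ?_⟩
  filter_upwards [hmem] with ξ ⟨B, hB, hξB⟩ hlt
  exact (hb ⟨B, hB⟩ ξ hξB hlt).trans (hc ⟨_, rfl⟩)

variable [Uncountable K] [CardinalInterFilter l #K]

theorem eventually_forall_lt (hg : IsLeastUnbounded l g) (hl : IsSaturated l) {P : K → K → Prop}
    (hP : ∀ η, ∀ᶠ ξ in l, P η ξ) : ∀ᶠ ξ in l, ∀ η < g ξ, P η ξ := by
  have hfail : ∀ ξ, ∃ η, (∃ η < g ξ, ¬ P η ξ) → η < g ξ ∧ ¬ P η ξ := fun ξ => by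
    by_cases h : ∃ η < g ξ, ¬ P η ξ
    · exact h.imp fun η hη _ => hη
    · exact ⟨ξ, fun h' => (h h').elim⟩
  choose h hh using hfail
  obtain ⟨b, hb⟩ := hg.exists_bound hl h
  have hPb : ∀ᶠ ξ in l, ∀ η ∈ Set.Iic b, P η ξ :=
    (eventually_cardinal_ball (mk_Iic_lt b)).2 fun η _ => hP η
  filter_upwards [hb, hPb] with ξ hξ hξP
  by_contra! hcon
  obtain ⟨hlt, hnot⟩ := hh ξ hcon
  exact hnot (hξP _ (hξ hlt))

theorem eventually_mem_closurePts (hg : IsLeastUnbounded l g) (hl : IsSaturated l) (F : K → K) :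
    ∀ᶠ ξ in l, g ξ ∈ closurePts F := by
  obtain ⟨η⟩ : Nonempty K := inferInstance
  filter_upwards [hg.tendsto.eventually_gt_atTop η,
    hg.eventually_forall_lt hl fun η => hg.tendsto.eventually_gt_atTop (F η)] with ξ hne hξ
  exact ⟨⟨η, hne⟩, hξ⟩

theorem eventually_lt_cof (hg : IsLeastUnbounded l g) (hl : IsSaturated l) {c : Cardinal}
    (hc : c < #K) : ∀ᶠ ξ in l, c < cof (Set.Iio (g ξ)) := by
  have hseq : ∀ ξ, ∃ φ : c.out → K, cof (Set.Iio (g ξ)) ≤ c →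
      ∀ b < g ξ, ∃ t, b ≤ φ t ∧ φ t < g ξ := fun ξ => by
    obtain ⟨S, hS, hcard⟩ := exists_cof_eq (Set.Iio (g ξ))
    by_cases hle : cof (Set.Iio (g ξ)) ≤ c
    · obtain ⟨e⟩ : Nonempty (S ↪ c.out) := by rwa [← Cardinal.le_def, mk_out, hcard]
      refine ⟨Function.extend e (fun a => a) fun _ => ξ, fun _ b hb => ?_⟩
      obtain ⟨a, ha, hba⟩ := hS ⟨b, hb⟩
      refine ⟨e ⟨a, ha⟩, ?_⟩
      rw [e.injective.extend_apply]
      exact ⟨hba, a.2⟩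
    · exact ⟨fun _ => ξ, fun h => (hle h).elim⟩
  choose φ hφ using hseq
  choose b hb using fun t => hg.exists_bound hl fun ξ => φ ξ t
  have hcard : #c.out < #K := by rwa [mk_out]
  obtain ⟨d, hd⟩ := bddAbove_of_mk_lt (mk_range_le.trans_lt hcard : #(Set.range b) < #K)
  obtain ⟨d', hd'⟩ := exists_gt d
  filter_upwards [hg.tendsto.eventually_gt_atTop d', (eventually_cardinal_forall hcard).2 hb]
    with ξ hξ hξb
  by_contra! hle
  obtain ⟨t, ht, hlt⟩ := hφ ξ hle d' hξ
  exact (hd'.trans_le ht).not_ge ((hξb t hlt).trans (hd ⟨t, rfl⟩))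

theorem eventually_isRegularCardinalOrder (hg : IsLeastUnbounded l g) (hl : IsSaturated l) :
    ∀ᶠ ξ in l, IsRegularCardinalOrder (Set.Iio (g ξ)) ∧ Uncountable (Set.Iio (g ξ)) := by
  filter_upwards [hg.eventually_lt_cof hl aleph0_lt_mk,
    hg.eventually_forall_lt hl fun η => hg.eventually_lt_cof hl (mk_Iio_lt η ord_cardinalMk)]
    with ξ hunc hreg
  refine ⟨isRegularCardinalOrder_of_forall_mk_Iio_lt fun i => lt_of_le_of_lt ?_ (hreg i i.2),
    aleph0_lt_mk_iff.1 (hunc.trans_le (cof_le_cardinalMk _))⟩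
  exact mk_le_of_injective (f := fun j : Set.Iio i => (⟨j.1.1, j.2⟩ : Set.Iio i.1))
    fun j j' h => Subtype.ext (Subtype.ext (Subtype.mk.inj h))

end IsLeastUnbounded

end Saturated

section Reflection

variable {K : Type u} [LinearOrder K] {X Y R G : Set K} {i η : K} {f : K → K}

theorem closurePts_anti {F F' : K → K} (h : F ≤ F') : closurePts F' ⊆ closurePts F :=
  fun _ hδ => ⟨hδ.1, fun _ hη => (h _).trans_lt (hδ.2 hη)⟩

theorem mem_closurePts_restrict (hf : Set.MapsTo f (Set.Iio i) (Set.Iio i)) (δ : Set.Iio i) :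
    δ ∈ closurePts hf.restrict ↔ (δ : K) ∈ closurePts f := by
  refine and_congr ⟨fun ⟨η, hη⟩ => ⟨η, hη⟩, fun ⟨η, hη⟩ => ⟨⟨η, hη.trans δ.2⟩, hη⟩⟩
    ⟨fun h η hη => h (x := ⟨η, hη.trans δ.2⟩) hη, fun h η hη => h (x := η) hη⟩

variable [WellFoundedLT K]

/-- The set `X` reflects at `i`: the order below `i` is that of a regular uncountable cardinal, in
which the trace of `X` is stationary. -/
structure ReflectsAt (X : Set K) (i : K) : Prop where
  regular : IsRegularCardinalOrder (Set.Iio i)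
  uncountable : Uncountable (Set.Iio i)
  isStationary : IsStationary (Subtype.val ⁻¹' X : Set (Set.Iio i))

theorem reflectsAt_iff [IsRegularCardinalOrder (Set.Iio i)] [Uncountable (Set.Iio i)] :
    ReflectsAt X i ↔
      ∀ f, Set.MapsTo f (Set.Iio i) (Set.Iio i) → ∃ δ ∈ X, δ < i ∧ δ ∈ closurePts f := by
  refine ⟨fun h f hf => ?_, fun h => ⟨‹_›, ‹_›, isStationary_iff_forall_closurePts.2 fun F => ?_⟩⟩
  · obtain ⟨δ, hδX, hδ⟩ := isStationary_iff_forall_closurePts.1 h.isStationary hf.restrict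
    exact ⟨δ, hδX, δ.2, (mem_closurePts_restrict hf δ).1 hδ⟩
  · have hF : ∀ η : Set.Iio i, Function.extend Subtype.val (fun η => (F η : K)) id η = F η :=
      fun η => Subtype.val_injective.extend_apply _ _ _
    have hmaps : Set.MapsTo (Function.extend Subtype.val (fun η => (F η : K)) id) (Set.Iio i)
        (Set.Iio i) := fun η hη => hF ⟨η, hη⟩ ▸ (F ⟨η, hη⟩).2
    obtain ⟨δ, hδX, hδi, hδ⟩ := h _ hmaps
    have hrestrict : hmaps.restrict = F := funext fun η => Subtype.ext (hF η)
    exact ⟨⟨δ, hδi⟩, hδX, hrestrict ▸ (mem_closurePts_restrict hmaps ⟨δ, hδi⟩).2 hδ⟩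

namespace ReflectsAt

theorem exists_mem_closurePts (h : ReflectsAt X i) (hf : Set.MapsTo f (Set.Iio i) (Set.Iio i)) :
    ∃ δ ∈ X, δ < i ∧ δ ∈ closurePts f :=
  have := h.regular
  have := h.uncountable
  reflectsAt_iff.1 h f hf

theorem exists_lt (h : ReflectsAt X i) : ∃ η, η < i := by
  obtain ⟨δ, -, hδ, -⟩ := h.exists_mem_closurePts (Set.mapsTo_id _)
  exact ⟨δ, hδ⟩

theorem exists_mem_Ioo (h : ReflectsAt X i) (hη : η < i) : ∃ δ ∈ X, δ ∈ Set.Ioo η i := by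
  obtain ⟨δ, hδX, hδi, ⟨η', hη'⟩, hδ⟩ := h.exists_mem_closurePts (f := fun _ => η) fun _ _ => hη
  exact ⟨δ, hδX, hδ hη', hδi⟩

theorem exists_le_of_disjoint_closurePts (h : ReflectsAt X i) (hf : Disjoint X (closurePts f)) :
    ∃ η < i, i ≤ f η := by
  by_contra! hcon
  obtain ⟨δ, hδX, -, hδ⟩ := h.exists_mem_closurePts (f := f) hcon
  exact Set.disjoint_left.1 hf hδX hδ

theorem or_of_union (h : ReflectsAt (X ∪ Y) i) : ReflectsAt X i ∨ ReflectsAt Y i := by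
  have := h.regular
  have := h.uncountable
  exact (isStationary_or_of_union (by simpa using h.isStationary)).imp
    (⟨‹_›, ‹_›, ·⟩) (⟨‹_›, ‹_›, ·⟩)

end ReflectsAt

theorem ReflectsAt.eventuallyEq (hX : ReflectsAt X i) (hη : η < i)
    (h : X ∩ Set.Ioo η i = Y ∩ Set.Ioo η i) :
    (Subtype.val ⁻¹' X : Set (Set.Iio i)) =ᶠ[atTop] (Subtype.val ⁻¹' Y : Set (Set.Iio i)) := by
  have := hX.regular
  have := hX.uncountable
  refine eventuallyEq_set.2 ((eventually_gt_atTop ⟨η, hη⟩).mono fun δ hδ => ?_)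
  simpa [show η < δ from hδ, show (δ : K) < i from δ.2] using Set.ext_iff.1 h δ

theorem ReflectsAt.of_inter_Ioo_eq (hX : ReflectsAt X i) (hη : η < i)
    (h : X ∩ Set.Ioo η i = Y ∩ Set.Ioo η i) : ReflectsAt Y i :=
  have := hX.regular
  have := hX.uncountable
  ⟨‹_›, ‹_›, isStationary_of_eventuallyEq hX.isStationary (hX.eventuallyEq hη h)⟩

/-- A reflection labelling attaches a label to certain sets at their reflection points. The label
depends only on the germ of the set at the point, and it can be prescribed by thinning out any
given reflecting part of the set. -/
structure IsReflectionLabelling (ℓ : K → Set K → Option (K × Bool)) : Prop where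
  reflectsAt : ∀ {X i v}, ℓ i X = some v → ReflectsAt X i
  congr : ∀ {X Y η i}, η < i → X ∩ Set.Ioo η i = Y ∩ Set.Ioo η i → ℓ i X = ℓ i Y
  exists_subset : ∀ {R G i}, ReflectsAt R i → Disjoint G R → ∀ j < i, ∀ ε,
    ∃ R' ⊆ R ∩ Set.Iio i, ℓ i (G ∪ R') = some (j, ε)

theorem IsReflectionLabelling.congr_Iio {ℓ : K → Set K → Option (K × Bool)}
    (hℓ : IsReflectionLabelling ℓ) (h : X ∩ Set.Iio i = Y ∩ Set.Iio i) : ℓ i X = ℓ i Y := by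
  by_cases hi : ∃ η, η < i
  · obtain ⟨η, hη⟩ := hi
    refine hℓ.congr hη ?_
    rw [← Set.Iio_inter_Ioi, ← Set.inter_assoc, h, Set.inter_assoc]
  · have hnone : ∀ Z, ℓ i Z = none := fun Z => Option.eq_none_iff_forall_ne_some.2 fun v hv =>
      hi (hℓ.reflectsAt hv).exists_lt
    rw [hnone, hnone]

theorem exists_labelling_Iio (i : K) : ∃ ℓ : Set (Set.Iio i) → Option (Set.Iio i × Bool),
    IsRegularCardinalOrder (Set.Iio i) → Uncountable (Set.Iio i) →
      (∀ S T : Set (Set.Iio i), S =ᶠ[atTop] T → ℓ S = ℓ T) ∧ ∀ R G, IsStationary R →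
        Disjoint G R → ∀ v, ∃ R' ⊆ R, IsStationary R' ∧ ℓ (G ∪ R') = some v := by
  by_cases h : IsRegularCardinalOrder (Set.Iio i) ∧ Uncountable (Set.Iio i)
  · obtain ⟨_, _⟩ := h
    have hinf : ℵ₀ ≤ #(Set.Iio i) := aleph0_le_mk _
    have hcard : #(Set.Iio i × Bool) ≤ #(Set (Set.Iio i)) := by
      have hset : #(Set.Iio i) ≤ #(Set (Set.Iio i)) := by
        rw [mk_set]
        exact (cantor _).le
      simpa [mul_eq_left hinf (ofNat_le_aleph0.trans hinf) two_ne_zero] using hset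
    exact (exists_labelling hcard).imp fun ℓ hℓ _ _ => hℓ
  · exact ⟨fun _ => none, fun hreg hunc => (h ⟨hreg, hunc⟩).elim⟩

theorem exists_isReflectionLabelling :
    ∃ ℓ : K → Set K → Option (K × Bool), IsReflectionLabelling ℓ := by
  classical
  choose ℓ hℓ using exists_labelling_Iio (K := K)
  let trace : (i : K) → Set K → Set (Set.Iio i) := fun i X => Subtype.val ⁻¹' X
  refine ⟨fun i X => if ReflectsAt X i then (ℓ i (trace i X)).map (Prod.map (↑) id) else none,
    ?_, ?_, ?_⟩
  · intro X i v hv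
    by_contra h
    simp [h] at hv
  · intro X Y η i hη h
    by_cases hX : ReflectsAt X i
    · have htrace : trace i X =ᶠ[atTop] trace i Y := hX.eventuallyEq hη h
      simp only [if_pos hX, if_pos (hX.of_inter_Ioo_eq hη h),
        (hℓ i hX.regular hX.uncountable).1 _ _ htrace]
    · simp only [if_neg hX, if_neg fun hY : ReflectsAt Y i => hX (hY.of_inter_Ioo_eq hη h.symm)]
  · intro R G i ⟨hreg, hunc, hR⟩ hGR j hj ε
    obtain ⟨R', hR'R, hR', hlabel⟩ := (hℓ i hreg hunc).2 _ (trace i G) hR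
      (hGR.preimage _) (⟨j, hj⟩, ε)
    have htrace : trace i (G ∪ Subtype.val '' R') = trace i G ∪ R' := by
      simp only [trace, Set.preimage_union, Set.preimage_image_eq _ Subtype.val_injective]
    have hreflects : ReflectsAt (G ∪ Subtype.val '' R') i := by
      refine ⟨hreg, hunc, ?_⟩
      change IsStationary (trace i _)
      exact htrace ▸ hR'.mono Set.subset_union_right
    refine ⟨Subtype.val '' R', ?_, ?_⟩
    · rintro _ ⟨δ, hδ, rfl⟩
      exact ⟨hR'R hδ, δ.2⟩
    · simp only [if_pos hreflects, htrace, hlabel]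
      rfl

theorem IsLeastUnbounded.exists_reflectsAt [IsRegularCardinalOrder K] [Uncountable K] {l : Filter K}
    [CardinalInterFilter l #K] [l.NeBot] {g : K → K} (hg : IsLeastUnbounded l g)
    (hl : IsSaturated l) {S : Set K} (hS : S ∈ l) : ∃ i, ReflectsAt (g '' S) i := by
  by_contra! hcon
  have hbad : ∀ ξ, ∃ f : K → K, IsRegularCardinalOrder (Set.Iio (g ξ)) ∧
      Uncountable (Set.Iio (g ξ)) → Set.MapsTo f (Set.Iio (g ξ)) (Set.Iio (g ξ)) ∧
        ∀ δ ∈ g '' S, δ < g ξ → δ ∉ closurePts f := fun ξ => by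
    by_cases h : IsRegularCardinalOrder (Set.Iio (g ξ)) ∧ Uncountable (Set.Iio (g ξ))
    · obtain ⟨_, _⟩ := h
      have := mt reflectsAt_iff.2 (hcon (g ξ))
      push Not at this
      exact this.imp fun f hf _ => hf
    · exact ⟨id, fun h' => (h h').elim⟩
  choose f hf using hbad
  -- The bound `b η` on the values `f ξ η < g ξ` does not depend on `ξ`, so a closure point `g ξ₀`
  -- of `b` is a closure point of `f ξ` for almost all `ξ`.
  choose b hb using fun η => hg.exists_bound hl fun ξ => f ξ η
  obtain ⟨ξ₀, hξ₀S, hξ₀⟩ :=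
    (Filter.Eventually.and hS (hg.eventually_mem_closurePts hl b)).exists
  have hfb : ∀ᶠ ξ in l, ∀ η ∈ Set.Iio (g ξ₀), f ξ η < g ξ → f ξ η ≤ b η :=
    (eventually_cardinal_ball (mk_Iio_lt _ ord_cardinalMk)).2 fun η _ => hb η
  obtain ⟨ξ, ⟨hreg, hlt⟩, hξ⟩ := ((hg.eventually_isRegularCardinalOrder hl).and
    (hg.tendsto.eventually_gt_atTop (g ξ₀)) |>.and hfb).exists
  obtain ⟨hmaps, hdisj⟩ := hf ξ hreg
  exact hdisj (g ξ₀) ⟨ξ₀, hξ₀S, rfl⟩ hlt ⟨hξ₀.1, fun η hη =>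
    (hξ η hη (hmaps (lt_trans hη hlt))).trans_lt (hξ₀.2 hη)⟩

end Reflection

section Approximation

variable {K : Type u}

/-- A set is trace-open if each of its points has a trace on a null set that forces membership. -/
def IsTraceOpen (l : Filter K) (U : Set (Set K)) : Prop :=
  ∀ x ∈ U, ∃ E, Eᶜ ∈ l ∧ ∀ y, y ∩ E = x ∩ E → y ∈ U

theorem IsTraceOpen.mono {l l' : Filter K} {U : Set (Set K)} (hU : IsTraceOpen l U) (h : l' ≤ l) :
    IsTraceOpen l' U := fun x hx =>
  (hU x hx).imp fun _ hE => ⟨h hE.1, hE.2⟩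

/-- A partial subset of `K`: membership is decided on the domain `dom`, where the members are the
points of `carrier`. -/
structure PartialSet (K : Type u) where
  carrier : Set K
  dom : Set K
  subset : carrier ⊆ dom

namespace PartialSet

variable {p q : PartialSet K} {x : Set K} {s : K → PartialSet K} {J : Set K}

instance : Inhabited (PartialSet K) := ⟨⟨∅, ∅, subset_rfl⟩⟩

/-- The set `x` has the members and non-members that the partial set `p` prescribes. -/
def IsTraceOf (p : PartialSet K) (x : Set K) : Prop := x ∩ p.dom = p.carrier

theorem isTraceOf_carrier (p : PartialSet K) : p.IsTraceOf p.carrier :=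
  Set.inter_eq_left.2 p.subset

/-- `p ≤ q` if the partial set `q` extends `p`. -/
instance : LE (PartialSet K) := ⟨fun p q => p.dom ⊆ q.dom ∧ p.IsTraceOf q.carrier⟩

theorem IsTraceOf.of_le (hq : q.IsTraceOf x) (hpq : p ≤ q) : p.IsTraceOf x := by
  have h := hpq.2
  rwa [← hq, IsTraceOf, Set.inter_assoc, Set.inter_eq_right.2 hpq.1] at h

theorem IsTraceOf.le (hp : p.IsTraceOf x) (hq : q.IsTraceOf x) (h : p.dom ⊆ q.dom) : p ≤ q := by
  refine ⟨h, ?_⟩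
  rw [IsTraceOf, ← hq, Set.inter_assoc, Set.inter_eq_right.2 h, hp]

instance : Preorder (PartialSet K) where
  le_refl p := ⟨subset_rfl, p.isTraceOf_carrier⟩
  le_trans _ _ _ hpq hqr := ⟨hpq.1.trans hqr.1, IsTraceOf.of_le hqr.2 hpq⟩

theorem IsTraceOf.carrier_eq (hp : p.IsTraceOf x) (hx : x ⊆ p.dom) : p.carrier = x :=
  hp.symm.trans (Set.inter_eq_left.2 hx)

/-- The set of the points that are put in by some `s m` with `m ∈ J`. -/
def limit (s : K → PartialSet K) (J : Set K) : Set K := ⋃ m ∈ J, (s m).carrier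

theorem mem_limit {i : K} : i ∈ limit s J ↔ ∃ m ∈ J, i ∈ (s m).carrier := by
  simp [limit]

end PartialSet

end Approximation

section EventSystem

open PartialSet

variable {K : Type u} [LinearOrder K] {l : Filter K}

/-- Increasing `Valid` partial sets `s m`, `m ∈ J`, where from stage `k` on nothing is added within
`front k`. -/
structure IsApproxChain (Valid : PartialSet K → Prop) (front : K → Set K) (J : Set K)
    (s : K → PartialSet K) : Prop where
  valid : ∀ k ∈ J, Valid (s k)
  le : ∀ k ∈ J, ∀ m < k, s m ≤ s k
  front_subset : ∀ k ∈ J, (s k).carrier ∩ front k ⊆ limit s (Set.Iio k)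

namespace IsApproxChain

variable {Valid : PartialSet K → Prop} {front : K → Set K} {J J' : Set K} {s : K → PartialSet K}

theorem mono (h : IsApproxChain Valid front J s) (hJ : J' ⊆ J) :
    IsApproxChain Valid front J' s :=
  ⟨fun k hk => h.valid k (hJ hk), fun k hk => h.le k (hJ hk), fun k hk => h.front_subset k (hJ hk)⟩

theorem isTraceOf_limit (h : IsApproxChain Valid front J s) {k : K} (hk : k ∈ J) :
    (s k).IsTraceOf (limit s J) := by
  refine Set.Subset.antisymm (fun i ⟨hi, hik⟩ => ?_) fun i hi =>
    ⟨mem_limit.2 ⟨k, hk, hi⟩, (s k).subset hi⟩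
  obtain ⟨m, hm, him⟩ := mem_limit.1 hi
  rcases lt_trichotomy m k with hmk | rfl | hmk
  · have him' : i ∈ (s k).carrier ∩ (s m).dom := (h.le k hk m hmk).2.symm ▸ him
    exact him'.1
  · exact him
  · exact (h.le m hm k hmk).2 ▸ ⟨him, hik⟩

end IsApproxChain

/-- A way of reading off from a set `x` a sequence of events, each with a label in `K` and a sign.
The valid partial sets decide only a null set, preserve their events in every extension and can be
extended by single events of arbitrary label and sign. -/
structure EventSystem (l : Filter K) where
  event : Set K → K → Option (K × Bool)
  Valid : PartialSet K → Prop
  front : K → Set K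
  compl_dom_mem : ∀ {p}, Valid p → p.domᶜ ∈ l
  compl_front_mem : ∀ k, (front k)ᶜ ∈ l
  event_of_isTraceOf : ∀ {p x i v}, Valid p → p.IsTraceOf x → event p.carrier i = some v →
    event x i = some v
  exists_event_of_limit : ∀ {J s i v}, IsLowerSet J → IsApproxChain Valid front J s →
    event (limit s J) i = some v → ∃ k ∈ J, event (s k).carrier i = some v
  exists_valid_isTraceOf_limit : ∀ {J s}, IsLowerSet J → IsApproxChain Valid front J s →
    ∀ {D}, Dᶜ ∈ l → ∃ p, Valid p ∧ p.IsTraceOf (limit s J) ∧ D ⊆ p.dom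
  exists_add_event : ∀ {p}, Valid p → ∀ k j ε, ∃ q i, Valid q ∧ p ≤ q ∧ k < i ∧
    event q.carrier i = some (j, ε) ∧ ∀ i' ≠ i, event q.carrier i' = event p.carrier i'

namespace EventSystem

variable {𝓔 : EventSystem l} {x A : Set K} {p : PartialSet K} {U : Set (Set K)} {i j k : K}
  {ε : Bool}

/-- A set is admissible if valid partial sets determine its traces on null sets. -/
def Admissible (𝓔 : EventSystem l) (x : Set K) : Prop :=
  ∀ D, Dᶜ ∈ l → ∃ p, 𝓔.Valid p ∧ p.IsTraceOf x ∧ D ⊆ p.dom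

/-- The last event of label `j` in `x` exists and has sign `ε`. -/
def IsLastEvent (𝓔 : EventSystem l) (x : Set K) (j : K) (ε : Bool) : Prop :=
  ∃ i, 𝓔.event x i = some (j, ε) ∧ ∀ i' > i, ∀ ε', 𝓔.event x i' ≠ some (j, ε')

/-- Every event of `x` of label below `k` is already an event of `A`, and the events of each
label are bounded. -/
structure Respects (𝓔 : EventSystem l) (k : K) (A x : Set K) : Prop where
  event_eq : ∀ j < k, ∀ i ε, 𝓔.event x i = some (j, ε) → 𝓔.event A i = some (j, ε)
  bounded : ∀ j, ∃ b, ∀ i ε, 𝓔.event x i = some (j, ε) → i ≤ b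

theorem IsLastEvent.unique {ε' : Bool} (h : 𝓔.IsLastEvent x j ε) (h' : 𝓔.IsLastEvent x j ε') :
    ε = ε' := by
  obtain ⟨i, hi, hlast⟩ := h
  obtain ⟨i', hi', hlast'⟩ := h'
  rcases lt_trichotomy i i' with hlt | rfl | hlt
  · exact absurd hi' (hlast i' hlt ε')
  · simpa [hi] using hi'
  · exact absurd hi (hlast' i hlt ε)

theorem Respects.of_isTraceOf (hx : 𝓔.Respects k A x) (hp : 𝓔.Valid p) (hpx : p.IsTraceOf x) :
    𝓔.Respects k A p.carrier where
  event_eq j hj i ε h := hx.event_eq j hj i ε (𝓔.event_of_isTraceOf hp hpx h)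
  bounded j := (hx.bounded j).imp fun _ hb i ε h => hb i ε (𝓔.event_of_isTraceOf hp hpx h)

theorem exists_decided (hU : IsTraceOpen l U) (hp : 𝓔.Valid p) (hA : 𝓔.Respects k A p.carrier) :
    ∃ q ε, 𝓔.Valid q ∧ p ≤ q ∧ 𝓔.Respects k A q.carrier ∧
      ∀ x, 𝓔.Admissible x → q.IsTraceOf x → 𝓔.Respects k A x → (x ∈ U ↔ ε = true) := by
  by_cases h : ∃ x ∈ U, 𝓔.Admissible x ∧ p.IsTraceOf x ∧ 𝓔.Respects k A x
  · obtain ⟨x, hxU, hx, hpx, hxA⟩ := h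
    obtain ⟨E, hE, hEU⟩ := hU x hxU
    obtain ⟨q, hq, hqx, hDq⟩ := hx (p.dom ∪ E) <| by
      rw [Set.compl_union]
      exact inter_mem (𝓔.compl_dom_mem hp) hE
    obtain ⟨hpq, hEq⟩ := Set.union_subset_iff.1 hDq
    refine ⟨q, true, hq, hpx.le hqx hpq, hxA.of_isTraceOf hq hqx, fun y _ hqy _ =>
      iff_of_true (hEU y ?_) rfl⟩
    rw [← Set.inter_eq_right.2 hEq, ← Set.inter_assoc, ← Set.inter_assoc, hqy, hqx]
  · exact ⟨p, false, hp, le_rfl, hA, fun x hx hpx hxA =>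
      iff_of_false (fun hxU => h ⟨x, hxU, hx, hpx, hxA⟩) (by simp)⟩

theorem exists_add_isLastEvent (hp : 𝓔.Valid p) (hA : 𝓔.Respects k A p.carrier) (ε : Bool) :
    ∃ q, 𝓔.Valid q ∧ p ≤ q ∧ 𝓔.Respects k A q.carrier ∧ 𝓔.IsLastEvent q.carrier k ε := by
  obtain ⟨b, hb⟩ := hA.bounded k
  obtain ⟨q, i, hq, hpq, hbi, hi, hne⟩ := 𝓔.exists_add_event hp b k ε
  refine ⟨q, hq, hpq, ⟨fun j hj i' ε' h => ?_, fun j => ?_⟩, i, hi, fun i' hi' ε' h => ?_⟩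
  · have hi' : i' ≠ i := by
      rintro rfl
      have hkj : k = j := congrArg Prod.fst (Option.some_injective _ (hi.symm.trans h))
      exact hj.ne' hkj
    exact hA.event_eq j hj i' ε' (hne i' hi' ▸ h)
  · obtain ⟨c, hc⟩ := hA.bounded j
    refine ⟨max c i, fun i' ε' h => ?_⟩
    by_cases hi' : i' = i
    · exact hi' ▸ le_max_right c i
    · exact (hc i' ε' (hne i' hi' ▸ h)).trans (le_max_left c i)
  · exact (hb i' ε' (hne i' hi'.ne' ▸ h)).not_gt (hbi.trans hi')

/-- The partial set `t` may be stage `k`, after the earlier stages `s`, of the construction of a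
set that belongs to exactly those `U k` for which the last event of label `k` is positive. -/
structure Stage (𝓔 : EventSystem l) (U : K → Set (Set K)) (k : K) (s : K → PartialSet K)
    (t : PartialSet K) : Prop where
  valid : 𝓔.Valid t
  le : ∀ m < k, s m ≤ t
  front_subset : t.carrier ∩ 𝓔.front k ⊆ limit s (Set.Iio k)
  respects : 𝓔.Respects k (limit s (Set.Iio k)) t.carrier
  decides : ∃ ε, 𝓔.IsLastEvent t.carrier k ε ∧ ∀ x, 𝓔.Admissible x → t.IsTraceOf x →
    𝓔.Respects k (limit s (Set.Iio k)) x → (x ∈ U k ↔ ε = true)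

namespace Stage

variable {U : K → Set (Set K)} {s s' : K → PartialSet K} {t : PartialSet K} {J : Set K}

theorem congr (hs : ∀ m < k, s m = s' m) (h : 𝓔.Stage U k s t) : 𝓔.Stage U k s' t := by
  have hlimit : limit s (Set.Iio k) = limit s' (Set.Iio k) :=
    Set.iUnion₂_congr fun m hm => congrArg PartialSet.carrier (hs m hm)
  obtain ⟨h₁, h₂, h₃, h₄, h₅⟩ := h
  rw [hlimit] at h₃ h₄ h₅
  exact ⟨h₁, fun m hm => hs m hm ▸ h₂ m hm, h₃, h₄, h₅⟩

theorem isApproxChain (h : ∀ k ∈ J, 𝓔.Stage U k s (s k)) :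
    IsApproxChain 𝓔.Valid 𝓔.front J s :=
  ⟨fun k hk => (h k hk).valid, fun k hk => (h k hk).le, fun k hk => (h k hk).front_subset⟩

variable [WellFoundedLT K]

theorem exists_event_of_limit (hJ : IsLowerSet J) (h : ∀ k ∈ J, 𝓔.Stage U k s (s k))
    (hi : 𝓔.event (limit s J) i = some (j, ε)) :
    ∃ m ∈ J, m ≤ j ∧ 𝓔.event (s m).carrier i = some (j, ε) := by
  obtain ⟨k, hk, hki⟩ := 𝓔.exists_event_of_limit hJ (isApproxChain h) hi
  induction k using WellFoundedLT.induction with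
  | ind k ih =>
    rcases le_or_gt k j with hkj | hjk
    · exact ⟨k, hk, hkj, hki⟩
    · obtain ⟨m, hm, hmi⟩ := 𝓔.exists_event_of_limit (isLowerSet_Iio k)
        (isApproxChain fun m hm => h m (hJ (le_of_lt hm) hk))
        ((h k hk).respects.event_eq j hjk i ε hki)
      exact ih m hm (hJ (le_of_lt hm) hk) hmi

theorem respects_limit [IsRegularCardinalOrder K] [Infinite K] (hJ : IsLowerSet J)
    (h : ∀ k ∈ J, 𝓔.Stage U k s (s k)) (k : K) :
    𝓔.Respects k (limit s (J ∩ Set.Iio k)) (limit s J) where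
  event_eq j hj i ε hi := by
    obtain ⟨m, hm, hmj, hmi⟩ := exists_event_of_limit hJ h hi
    have hchain := (isApproxChain h).mono Set.inter_subset_left (J' := J ∩ Set.Iio k)
    exact 𝓔.event_of_isTraceOf (h m hm).valid
      (hchain.isTraceOf_limit ⟨hm, hmj.trans_lt hj⟩) hmi
  bounded j := by
    have hb : ∀ m, ∃ b, m ∈ J → ∀ i ε, 𝓔.event (s m).carrier i = some (j, ε) → i ≤ b := fun m => by
      by_cases hm : m ∈ J
      · exact ((h m hm).respects.bounded j).imp fun b hb _ => hb
      · exact ⟨j, fun hm' => (hm hm').elim⟩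
    choose b hb using hb
    obtain ⟨c, hc⟩ := bddAbove_image_of_mk_lt (mk_Iic_lt j) b
    refine ⟨c, fun i ε hi => ?_⟩
    obtain ⟨m, hm, hmj, hmi⟩ := exists_event_of_limit hJ h hi
    exact (hb m hm i ε hmi).trans (hc ⟨m, hmj, rfl⟩)

end Stage

variable [WellFoundedLT K] [IsRegularCardinalOrder K] [Infinite K] [CardinalInterFilter l #K]

theorem exists_stage {U : K → Set (Set K)} (hU : IsTraceOpen l (U k)) {s : K → PartialSet K}
    (h : ∀ m < k, 𝓔.Stage U m s (s m)) : ∃ t, 𝓔.Stage U k s t := by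
  have hchain : IsApproxChain 𝓔.Valid 𝓔.front (Set.Iio k) s := Stage.isApproxChain h
  have hdom : (⋃ m ∈ Set.Iio k, (s m).dom)ᶜ ∈ l := by
    simp only [Set.compl_iUnion]
    exact (cardinal_bInter_mem (mk_Iio_lt k ord_cardinalMk)).2 fun m hm =>
      𝓔.compl_dom_mem (h m hm).valid
  obtain ⟨p, hp, hlimit, hDp⟩ := 𝓔.exists_valid_isTraceOf_limit (isLowerSet_Iio k) hchain
    (D := (⋃ m ∈ Set.Iio k, (s m).dom) ∪ 𝓔.front k) <| by
      rw [Set.compl_union]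
      exact inter_mem hdom (𝓔.compl_front_mem k)
  obtain ⟨hsp, hfront⟩ := Set.union_subset_iff.1 hDp
  have hcarrier : p.carrier = limit s (Set.Iio k) := hlimit.carrier_eq <|
    (Set.iUnion₂_mono fun m _ => (s m).subset).trans hsp
  have hrespects : 𝓔.Respects k (limit s (Set.Iio k)) p.carrier := by
    simpa only [Set.inter_self, hcarrier] using Stage.respects_limit (isLowerSet_Iio k) h k
  obtain ⟨q, ε, hq, hpq, hqA, hdecide⟩ := exists_decided hU hp hrespects
  obtain ⟨t, ht, hqt, htA, hlast⟩ := exists_add_isLastEvent hq hqA ε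
  have hpt := hpq.trans hqt
  refine ⟨t, ht, fun m hm => ?_, ?_, htA, ε, hlast, fun x hx htx => hdecide x hx (htx.of_le hqt)⟩
  · exact ((hchain.isTraceOf_limit hm).le hlimit fun i hi =>
      hsp (Set.mem_biUnion hm hi)).trans hpt
  · rw [← hcarrier, ← hpt.2]
    exact Set.inter_subset_inter_right _ hfront

theorem exists_forall_mem_iff (𝓔 : EventSystem l) {U : K → Set (Set K)}
    (hU : ∀ k, IsTraceOpen l (U k)) : ∃ x, ∀ k, x ∈ U k ↔ 𝓔.IsLastEvent x k true := by
  obtain ⟨s, hs⟩ := exists_forall_rel_of_wellFoundedLT (𝓔.Stage U) (fun _ _ _ _ => Stage.congr)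
    fun k _ => exists_stage (hU k)
  have hs' : ∀ k ∈ Set.univ, 𝓔.Stage U k s (s k) := fun k _ => hs k
  have hchain := Stage.isApproxChain hs'
  have hadm : 𝓔.Admissible (limit s Set.univ) := fun D =>
    𝓔.exists_valid_isTraceOf_limit isLowerSet_univ hchain
  refine ⟨limit s Set.univ, fun k => ?_⟩
  have htrace := hchain.isTraceOf_limit (Set.mem_univ k)
  obtain ⟨ε, ⟨i, hi, hi'⟩, hdecide⟩ := (hs k).decides
  have hlast : 𝓔.IsLastEvent (limit s Set.univ) k ε := by
    refine ⟨i, 𝓔.event_of_isTraceOf (hs k).valid htrace hi, fun i' hii' ε' h => hi' i' hii' ε' ?_⟩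
    obtain ⟨m, -, hmk, hm⟩ := Stage.exists_event_of_limit isLowerSet_univ hs' h
    rcases hmk.eq_or_lt with rfl | hmk
    · exact hm
    · exact 𝓔.event_of_isTraceOf (hs m).valid ((hs k).le m hmk).2 hm
  have hrespects := Stage.respects_limit isLowerSet_univ hs' k
  rw [Set.univ_inter] at hrespects
  rw [hdecide _ hadm htrace hrespects]
  exact ⟨fun h => h ▸ hlast, hlast.unique⟩

end EventSystem

end EventSystem

section Fibres

open Classical in
theorem exists_eventSystem_of_fibres {K : Type u} [LinearOrder K] [NoMaxOrder K] {l : Filter K}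
    (hl : l ≤ atTop) {f : K → K × Bool} (hf : ∀ v, ∃ᶠ i in l, f i = v) :
    ∃ 𝓔 : EventSystem l, ∀ x i, 𝓔.event x i = if i ∈ x then some (f i) else none := by
  refine ⟨{
    event := fun x i => if i ∈ x then some (f i) else none
    Valid := fun p => p.domᶜ ∈ l
    front := fun _ => ∅
    compl_dom_mem := id
    compl_front_mem := fun _ => by simp
    event_of_isTraceOf := ?_
    exists_event_of_limit := ?_
    exists_valid_isTraceOf_limit := ?_
    exists_add_event := ?_ }, fun _ _ => rfl⟩
  · intro p x i v _ hpx hi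
    simp only [Option.ite_none_right_eq_some] at hi ⊢
    exact ⟨(hpx.symm ▸ hi.1 : i ∈ x ∩ p.dom).1, hi.2⟩
  · intro J s i v _ _ hi
    simp only [Option.ite_none_right_eq_some, PartialSet.mem_limit] at hi ⊢
    obtain ⟨⟨k, hk, hik⟩, hv⟩ := hi
    exact ⟨k, hk, hik, hv⟩
  · exact fun {J s} _ _ {D} hD =>
      ⟨⟨PartialSet.limit s J ∩ D, D, Set.inter_subset_right⟩, hD, rfl, subset_rfl⟩
  · intro p hp k j ε
    obtain ⟨i, hi, hip, hki⟩ :=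
      ((hf (j, ε)).and_eventually (Filter.Eventually.and hp (hl (Ioi_mem_atTop k)))).exists
    refine ⟨⟨insert i p.carrier, insert i p.dom, Set.insert_subset_insert p.subset⟩, i, ?_,
      ⟨Set.subset_insert i p.dom, ?_⟩, hki, by simp [hi], fun i' hi' => by simp [hi']⟩
    · filter_upwards [hp, hl (Ioi_mem_atTop i)] with i' hi' hlt
      exact fun h => h.elim (ne_of_gt hlt) hi'
    · rw [PartialSet.IsTraceOf, Set.insert_inter_of_notMem hip, p.isTraceOf_carrier]

end Fibres

section StationaryEvents

variable {K : Type u} [LinearOrder K]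

theorem notMem_closurePts_of_mem_Ioo {F : K → K} {η δ i : K} (hF : i ≤ F η)
    (hδ : δ ∈ Set.Ioo η i) : δ ∉ closurePts F := fun h =>
  (hδ.2.trans_le hF).not_gt (h.2 hδ.1)

/-- The closure points of `F` separate the decided part of `p` from the rest: no member of `p` is
mapped to a closure point, and every point that is mapped elsewhere is decided. This is what keeps
the reflection points of `g '' p.carrier` under control in every extension of `p`. -/
structure IsClubWitness (g F : K → K) (p : PartialSet K) : Prop where
  notMem_closurePts : ∀ ξ ∈ p.carrier, g ξ ∉ closurePts F
  mem_dom : ∀ ξ, g ξ ∉ closurePts F → ξ ∈ p.dom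

namespace IsClubWitness

variable {g F : K → K} {p : PartialSet K} {x : Set K} {i η : K}

theorem disjoint_image (h : IsClubWitness g F p) : Disjoint (g '' p.carrier) (closurePts F) := by
  rw [Set.disjoint_left, Set.forall_mem_image]
  exact h.notMem_closurePts

theorem image_inter_Ioo_eq (h : IsClubWitness g F p) (hx : p.IsTraceOf x) (hF : i ≤ F η) :
    g '' p.carrier ∩ Set.Ioo η i = g '' x ∩ Set.Ioo η i := by
  refine Set.Subset.antisymm (Set.inter_subset_inter_left _ (Set.image_mono ?_)) ?_
  · exact hx ▸ Set.inter_subset_left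
  · rintro _ ⟨⟨ξ, hξ, rfl⟩, hδ⟩
    exact ⟨⟨ξ, hx ▸ ⟨hξ, h.mem_dom ξ (notMem_closurePts_of_mem_Ioo hF hδ)⟩, rfl⟩, hδ⟩

end IsClubWitness

variable [WellFoundedLT K]

theorem exists_closurePts_subset_diagonal [IsRegularCardinalOrder K] [Infinite K] (F : K → K → K) :
    ∃ f : K → K, ∀ δ ∈ closurePts f, ∀ m < δ, δ ∈ closurePts (F m) := by
  have hmk : ∀ η : K, #(Set.Iic η ×ˢ Set.Iic η : Set (K × K)) < #K := fun η => by
    rw [mk_setProd]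
    exact mul_lt_of_lt (aleph0_le_mk K) (mk_Iic_lt η) (mk_Iic_lt η)
  choose f hf using fun η => bddAbove_image_of_mk_lt (hmk η) fun q => F q.1 q.2
  refine ⟨f, fun δ hδ m hm => ⟨hδ.1, fun η hη => ?_⟩⟩
  have hbound : F m η ≤ f (max m η) := hf _ ⟨(m, η), ⟨le_max_left _ _, le_max_right _ _⟩, rfl⟩
  exact hbound.trans_lt (hδ.2 (max_lt hm hη))

theorem ReflectsAt.mono {X Y : Set K} {i : K} (h : ReflectsAt X i) (hXY : X ⊆ Y) :
    ReflectsAt Y i :=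
  ⟨h.regular, h.uncountable, h.isStationary.mono (Set.preimage_mono hXY)⟩

theorem ReflectsAt.exists_mem_diagonal {X : Set K} {i : K} (h : ReflectsAt X i) {F : K → K → K}
    (hF : ∀ m, Set.MapsTo (F m) (Set.Iio i) (Set.Iio i)) :
    ∃ δ ∈ X, ∀ m < δ, δ ∈ closurePts (F m) := by
  have := h.regular
  have := h.uncountable
  obtain ⟨f, hf⟩ := exists_closurePts_subset_diagonal fun m : Set.Iio i => (hF m).restrict
  obtain ⟨δ, hδX, hδ⟩ := isStationary_iff_forall_closurePts.1 h.isStationary f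
  exact ⟨δ, hδX, fun m hm =>
    (mem_closurePts_restrict (hF m) δ).1 (hf δ hδ ⟨m, hm.trans δ.2⟩ hm)⟩

theorem IsClubWitness.label_of_isTraceOf {g F : K → K} {p : PartialSet K} {x : Set K} {i : K}
    (h : IsClubWitness g F p) (hx : p.IsTraceOf x)
    {ℓ : K → Set K → Option (K × Bool)} (hℓ : IsReflectionLabelling ℓ) {v : K × Bool}
    (hv : ℓ i (g '' p.carrier) = some v) : ℓ i (g '' x) = some v := by
  obtain ⟨η, hη, hF⟩ := (hℓ.reflectsAt hv).exists_le_of_disjoint_closurePts h.disjoint_image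
  rw [← hℓ.congr hη (h.image_inter_Ioo_eq hx hF), hv]

namespace IsApproxChain

variable {g : K → K} {Valid : PartialSet K → Prop} {J : Set K} {s : K → PartialSet K}

theorem exists_notMem_closurePts (hs : IsApproxChain Valid (fun k => {ξ | g ξ ≤ k}) J s)
    (hJ : IsLowerSet J) {F : K → K → K} (hF : ∀ m ∈ J, IsClubWitness g (F m) (s m)) {ξ : K}
    (hξ : ξ ∈ PartialSet.limit s J) : ∃ m < g ξ, g ξ ∉ closurePts (F m) := by
  obtain ⟨m, hm, hξm⟩ := PartialSet.mem_limit.1 hξ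
  induction m using WellFoundedLT.induction with
  | ind m ih =>
    rcases le_or_gt (g ξ) m with hle | hlt
    · obtain ⟨m', hm', hξm'⟩ := PartialSet.mem_limit.1 (hs.front_subset m hm ⟨hξm, hle⟩)
      exact ih m' hm' (hJ (le_of_lt hm') hm) hξm'
    · exact ⟨m, hlt, (hF m hm).notMem_closurePts ξ hξm⟩

theorem exists_label_of_limit (hs : IsApproxChain Valid (fun k => {ξ | g ξ ≤ k}) J s)
    (hJ : IsLowerSet J) (hValid : ∀ p, Valid p → ∃ F, IsClubWitness g F p)
    {ℓ : K → Set K → Option (K × Bool)} (hℓ : IsReflectionLabelling ℓ) {i : K} {v : K × Bool}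
    (hv : ℓ i (g '' PartialSet.limit s J) = some v) :
    ∃ k ∈ J, ℓ i (g '' (s k).carrier) = some v := by
  by_cases hescape : ∃ k ∈ J, ∃ F, IsClubWitness g F (s k) ∧ ∃ η < i, i ≤ F η
  · obtain ⟨k, hk, F, hF, η, hη, hiF⟩ := hescape
    refine ⟨k, hk, ?_⟩
    rw [hℓ.congr hη (hF.image_inter_Ioo_eq (hs.isTraceOf_limit hk) hiF), hv]
  · have hF : ∀ m, ∃ F, Set.MapsTo F (Set.Iio i) (Set.Iio i) ∧
        (m ∈ J → IsClubWitness g F (s m)) := fun m => by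
      by_cases hm : m ∈ J
      · obtain ⟨F, hF⟩ := hValid _ (hs.valid m hm)
        exact ⟨F, fun η hη => not_le.1 fun hiF => hescape ⟨m, hm, F, hF, η, hη, hiF⟩, fun _ => hF⟩
      · exact ⟨id, Set.mapsTo_id _, fun hm' => (hm hm').elim⟩
    choose F hmaps hF using hF
    obtain ⟨_, ⟨ξ, hξ, rfl⟩, hdiag⟩ := (hℓ.reflectsAt hv).exists_mem_diagonal hmaps
    obtain ⟨m, hm, hξm⟩ := hs.exists_notMem_closurePts hJ hF hξ
    exact (hξm (hdiag m hm)).elim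

theorem exists_disjoint_closurePts [IsRegularCardinalOrder K] [Infinite K]
    (hs : IsApproxChain Valid (fun k => {ξ | g ξ ≤ k}) J s) (hJ : IsLowerSet J)
    (hValid : ∀ p, Valid p → ∃ F, IsClubWitness g F p) :
    ∃ f, ∀ ξ ∈ PartialSet.limit s J, g ξ ∉ closurePts f := by
  choose! F hF using fun m (hm : m ∈ J) => hValid _ (hs.valid m hm)
  obtain ⟨f, hf⟩ := exists_closurePts_subset_diagonal F
  refine ⟨f, fun ξ hξ hcl => ?_⟩
  obtain ⟨m, hm, hξm⟩ := hs.exists_notMem_closurePts hJ hF hξ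
  exact hξm (hf _ hcl m hm)

end IsApproxChain

namespace IsReflectionLabelling

variable {ℓ : K → Set K → Option (K × Bool)} {G R : Set K} {F : K → K} {i i' : K}

theorem union_eq_of_not_reflectsAt (hℓ : IsReflectionLabelling ℓ) (hG : Disjoint G (closurePts F))
    (hR : R ⊆ closurePts F) (hRi : ¬ ReflectsAt R i) : ℓ i (G ∪ R) = ℓ i G := by
  by_cases hGi : ReflectsAt G i
  · obtain ⟨η, hη, hF⟩ := hGi.exists_le_of_disjoint_closurePts hG
    have hRη : R ∩ Set.Ioo η i = ∅ := Set.disjoint_iff_inter_eq_empty.1 <|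
      Set.disjoint_left.2 fun δ hδ hδη => notMem_closurePts_of_mem_Ioo hF hδη (hR hδ)
    exact hℓ.congr hη (by rw [Set.union_inter_distrib_right, hRη, Set.union_empty])
  · have hnone : ∀ {X}, ¬ ReflectsAt X i → ℓ i X = none := fun hX =>
      Option.eq_none_iff_forall_ne_some.2 fun _ hv => hX (hℓ.reflectsAt hv)
    rw [hnone hGi, hnone fun h => h.or_of_union.elim hGi hRi]

theorem union_eq_of_subset_Iio (hℓ : IsReflectionLabelling ℓ) (hR : R ⊆ Set.Iio i) (hi : i < i') :
    ℓ i' (G ∪ R) = ℓ i' G := by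
  have hRi : R ∩ Set.Ioo i i' = ∅ := Set.disjoint_iff_inter_eq_empty.1 <|
    Set.disjoint_left.2 fun δ hδ hδi => (hR hδ).not_gt hδi.1
  exact hℓ.congr hi (by rw [Set.union_inter_distrib_right, hRi, Set.union_empty])

end IsReflectionLabelling

variable [IsRegularCardinalOrder K] [Uncountable K] {l : Filter K} [CardinalInterFilter l #K]
  {g : K → K} {p : PartialSet K}

theorem IsLeastUnbounded.exists_isClubWitness (hg : IsLeastUnbounded l g) (hl : IsSaturated l)
    {x D : Set K} {f : K → K} (hx : ∀ ξ ∈ x, g ξ ∉ closurePts f) (hD : Dᶜ ∈ l) :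
    ∃ p, (p.domᶜ ∈ l ∧ IsClubWitness g f p) ∧ p.carrier = x ∧ D ⊆ p.dom := by
  refine ⟨⟨x, D ∪ g ⁻¹' (closurePts f)ᶜ, fun ξ hξ => Or.inr (hx ξ hξ)⟩,
    ⟨?_, hx, fun ξ hξ => Or.inr hξ⟩, rfl, Set.subset_union_left⟩
  filter_upwards [hD, hg.eventually_mem_closurePts hl f] with ξ hξ hcl
  exact fun h => h.elim hξ fun hncl => hncl hcl

theorem IsLeastUnbounded.exists_add_label [l.NeBot] (hg : IsLeastUnbounded l g)
    (hl : IsSaturated l) {ℓ : K → Set K → Option (K × Bool)} (hℓ : IsReflectionLabelling ℓ)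
    {F : K → K} (hp : p.domᶜ ∈ l) (hF : IsClubWitness g F p) (k j : K) (ε : Bool) :
    ∃ r i, Disjoint r p.dom ∧ (∀ ξ ∈ r, g ξ < i) ∧ k < i ∧
      ℓ i (g '' (p.carrier ∪ r)) = some (j, ε) ∧
      ∀ i' ≠ i, ℓ i' (g '' (p.carrier ∪ r)) = ℓ i' (g '' p.carrier) := by
  let S : Set K := {ξ | ξ ∉ p.dom ∧ max k j < g ξ}
  have hS : S ∈ l := Filter.Eventually.and hp (hg.tendsto.eventually_gt_atTop _)
  obtain ⟨i, hi, hmin⟩ := WellFounded.has_min (wellFounded_lt (α := K)) {i | ReflectsAt (g '' S) i}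
    (hg.exists_reflectsAt hl hS)
  have hSF : g '' S ⊆ closurePts F := by
    rintro _ ⟨ξ, hξ, rfl⟩
    exact not_not.1 fun h => hξ.1 (hF.mem_dom ξ h)
  have hkj : max k j < i := by
    obtain ⟨η, hη⟩ := hi.exists_lt
    obtain ⟨_, ⟨ξ, hξ, rfl⟩, hξi⟩ := hi.exists_mem_Ioo hη
    exact hξ.2.trans hξi.2
  obtain ⟨R, hRS, hR⟩ := hℓ.exists_subset hi (hF.disjoint_image.mono_right hSF) j
    ((le_max_right k j).trans_lt hkj) ε
  obtain ⟨hRS, hRi⟩ := Set.subset_inter_iff.1 hRS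
  have himage : g '' (p.carrier ∪ S ∩ g ⁻¹' R) = g '' p.carrier ∪ R := by
    rw [Set.image_union, Set.image_inter_preimage, Set.inter_eq_right.2 hRS]
  refine ⟨S ∩ g ⁻¹' R, i, Set.disjoint_left.2 fun ξ hξ => hξ.1.1, fun ξ hξ => hRi hξ.2,
    (le_max_left k j).trans_lt hkj, by rw [himage, hR], fun i' hi' => ?_⟩
  rw [himage]
  rcases hi'.lt_or_gt with hlt | hlt
  · exact hℓ.union_eq_of_not_reflectsAt hF.disjoint_image (hRS.trans hSF) fun h =>
      hmin i' (h.mono hRS) hlt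
  · exact hℓ.union_eq_of_subset_Iio hRi hlt

theorem IsLeastUnbounded.exists_eventSystem [l.NeBot] (hg : IsLeastUnbounded l g)
    (hl : IsSaturated l) {ℓ : K → Set K → Option (K × Bool)} (hℓ : IsReflectionLabelling ℓ) :
    ∃ 𝓔 : EventSystem l, ∀ x i, 𝓔.event x i = ℓ i (g '' x) := by
  have hValid : ∀ p : PartialSet K, p.domᶜ ∈ l ∧ (∃ F, IsClubWitness g F p) →
      ∃ F, IsClubWitness g F p := fun p => And.right
  refine ⟨{
    event := fun x i => ℓ i (g '' x)
    Valid := fun p => p.domᶜ ∈ l ∧ ∃ F, IsClubWitness g F p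
    front := fun k => {ξ | g ξ ≤ k}
    compl_dom_mem := And.left
    compl_front_mem := fun k =>
      (hg.tendsto.eventually_gt_atTop k).mono fun ξ hξ => not_le.2 hξ
    event_of_isTraceOf := fun ⟨_, F, hF⟩ hpx hv => hF.label_of_isTraceOf hpx hℓ hv
    exists_event_of_limit := fun hJ hs hv => hs.exists_label_of_limit hJ hValid hℓ hv
    exists_valid_isTraceOf_limit := ?_
    exists_add_event := ?_ }, fun _ _ => rfl⟩
  · intro J s hJ hs D hD
    obtain ⟨f, hf⟩ := hs.exists_disjoint_closurePts hJ hValid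
    obtain ⟨p, ⟨hp, hpf⟩, hcarrier, hDp⟩ := hg.exists_isClubWitness hl hf hD
    exact ⟨p, ⟨hp, f, hpf⟩, hcarrier ▸ p.isTraceOf_carrier, hDp⟩
  · rintro p ⟨hp, F, hF⟩ k j ε
    obtain ⟨r, i, hr, hri, hki, hi, hne⟩ := hg.exists_add_label hl hℓ hp hF k j ε
    have hmax : ∀ ξ ∈ p.carrier ∪ r, g ξ ∉ closurePts fun η => max (F η) i := by
      rintro ξ (hξ | hξ) hcl
      · exact hF.notMem_closurePts ξ hξ (closurePts_anti (fun η => le_max_left (F η) i) hcl)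
      · obtain ⟨η, hη⟩ := hcl.1
        exact ((le_max_right (F η) i).trans_lt (hcl.2 hη)).not_gt (hri ξ hξ)
    obtain ⟨q, ⟨hq, hqF⟩, hcarrier, hpq⟩ := hg.exists_isClubWitness hl hmax hp
    refine ⟨q, i, ⟨hq, _, hqF⟩, ⟨hpq, ?_⟩, hki, hcarrier ▸ hi, hcarrier ▸ hne⟩
    rw [PartialSet.IsTraceOf, hcarrier, Set.union_inter_distrib_right, hr.inter_eq,
      Set.union_empty, p.isTraceOf_carrier]

end StationaryEvents

section LocalEventSystem

variable {K : Type u} [LinearOrder K] [WellFoundedLT K] [IsRegularCardinalOrder K] [Uncountable K]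
  {l : Filter K} [l.NeBot] [CardinalInterFilter l #K]

theorem exists_local_eventSystem (hl : l ≤ atTop) :
    ∃ l' ≤ l, ∃ (_ : CardinalInterFilter l' #K) (𝓔 : EventSystem l'),
      ∀ i, ∃ B, Bᶜ ∈ l ∧ ∀ x y, x ∩ B = y ∩ B → 𝓔.event x i = 𝓔.event y i := by
  classical
  by_cases hsat : IsSaturated l
  · obtain ⟨A, hA, g, hg, hmin⟩ := hsat.exists_isLeastUnbounded hl
    obtain ⟨ℓ, hℓ⟩ := exists_isReflectionLabelling (K := K)
    have : (l ⊓ 𝓟 A).NeBot := frequently_mem_iff_neBot.1 hA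
    obtain ⟨𝓔, h𝓔⟩ := hmin.exists_eventSystem (hsat.mono inf_le_left) hℓ
    refine ⟨l ⊓ 𝓟 A, inf_le_left, inferInstance, 𝓔, fun i => ⟨g ⁻¹' Set.Iio i, ?_,
      fun x y hxy => ?_⟩⟩
    · filter_upwards [hg.eventually_ge_atTop i] with ξ hξ using hξ.not_gt
    · rw [h𝓔, h𝓔]
      exact hℓ.congr_Iio (by rw [← Set.image_inter_preimage, hxy, Set.image_inter_preimage])
  · obtain ⟨f, hf⟩ := exists_frequently_eq_of_not_isSaturated hsat
    obtain ⟨𝓔, h𝓔⟩ := exists_eventSystem_of_fibres hl hf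
    refine ⟨l, le_rfl, inferInstance, 𝓔, fun i => ⟨{i}, ?_, fun x y hxy => ?_⟩⟩
    · filter_upwards [hl (Ioi_mem_atTop i)] with ξ hξ using ne_of_gt hξ
    · have hi : i ∈ x ↔ i ∈ y := by simpa using Set.ext_iff.1 hxy i
      simp only [h𝓔, hi]

end LocalEventSystem

section IdealTopology

variable {K : Type u} {ν : Type v} {I : Order.Ideal (Set K)}

/-- The filter of the complements of the members of `I`. -/
def dualFilter (I : Order.Ideal (Set K)) : Filter K :=
  comk (· ∈ I) I.bot_mem (fun _ hD _ h => I.lower h hD) fun _ hD _ hE => Order.Ideal.sup_mem hD hE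

theorem compl_mem_dualFilter {D : Set K} : Dᶜ ∈ dualFilter I ↔ D ∈ I := by
  rw [dualFilter, mem_comk, compl_compl]

theorem neBot_dualFilter (hI : I.IsProper) : (dualFilter I).NeBot := by
  refine neBot_iff.2 fun h => hI.ne_univ (Set.eq_univ_of_forall fun D => ?_)
  exact compl_mem_dualFilter.1 (h ▸ mem_bot)

theorem IsComplete.cardinalInterFilter_dualFilter {κ : Cardinal.{u}} (hI : IsComplete κ I) :
    CardinalInterFilter (dualFilter I) κ where
  cardinal_sInter_mem S hS hmem := by
    rw [← compl_compl (⋂₀ S), compl_mem_dualFilter, Set.compl_sInter]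
    refine hI _ ?_ (mk_image_le.trans_lt hS)
    rintro _ ⟨s, hs, rfl⟩
    exact hmem s hs

theorem dualFilter_le_atTop [LinearOrder K] [Nonempty K] (hI : ExtendsBounded I) :
    dualFilter I ≤ atTop := fun s hs => by
  obtain ⟨a, ha⟩ := mem_atTop_sets.1 hs
  exact hI sᶜ ⟨a, fun b hb => (not_le.1 fun hab => hb (ha b hab)).le⟩

theorem exists_forall_eqOn_mem_of_isOpen {U : Set (K → ν)} (hU : IsOpen[idealTopology I ν] U)
    {x : K → ν} (hx : x ∈ U) : ∃ D ∈ I, ∀ y, Set.EqOn y x D → y ∈ U := by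
  induction hU generalizing x with
  | basic s hs =>
    obtain ⟨D, hD, f, rfl⟩ := hs
    exact ⟨D, hD, fun y hy i => (hy i.2).trans (hx i)⟩
  | univ => exact ⟨⊥, I.bot_mem, fun _ _ => trivial⟩
  | inter s t _ _ ihs iht =>
    obtain ⟨D, hD, h⟩ := ihs hx.1
    obtain ⟨D', hD', h'⟩ := iht hx.2
    exact ⟨D ⊔ D', Order.Ideal.sup_mem hD hD', fun y hy =>
      ⟨h y (hy.mono Set.subset_union_left), h' y (hy.mono Set.subset_union_right)⟩⟩
  | sUnion S _ ih =>
    obtain ⟨s, hs, hxs⟩ := hx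
    obtain ⟨D, hD, h⟩ := ih s hs hxs
    exact ⟨D, hD, fun y hy => ⟨s, hs, h y hy⟩⟩

theorem isOpen_of_forall_exists_eqOn {U : Set (K → ν)}
    (h : ∀ x ∈ U, ∃ D ∈ I, ∀ y, Set.EqOn y x D → y ∈ U) : IsOpen[idealTopology I ν] U := by
  let _ := idealTopology I ν
  refine isOpen_iff_forall_mem_open.2 fun x hx => ?_
  obtain ⟨D, hD, h⟩ := h x hx
  exact ⟨cone fun i : D => x i, fun y hy => h y fun i hi => hy ⟨i, hi⟩,
    TopologicalSpace.isOpen_generateFrom_of_mem ⟨D, hD, _, rfl⟩, fun _ => rfl⟩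

open Classical in
/-- The function with value `p` on `A` and value `q` off `A`: the point of the space that encodes
the set `A`. -/
noncomputable def twoValued (p q : ν) (A : Set K) : K → ν := fun i => if i ∈ A then p else q

theorem preimage_twoValued {p q : ν} (hpq : p ≠ q) (A : Set K) : twoValued p q A ⁻¹' {p} = A := by
  ext i
  by_cases hi : i ∈ A <;> simp [twoValued, hi, hpq.symm]

theorem isTraceOpen_preimage_twoValued {U : Set (K → ν)} (hU : IsOpen[idealTopology I ν] U)
    (p q : ν) : IsTraceOpen (dualFilter I) (twoValued p q ⁻¹' U) := fun A hA => by
  obtain ⟨D, hD, h⟩ := exists_forall_eqOn_mem_of_isOpen hU hA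
  refine ⟨D, compl_mem_dualFilter.2 hD, fun A' hA' => h _ fun i hi => ?_⟩
  have hiA : i ∈ A' ↔ i ∈ A := by simpa [hi] using Set.ext_iff.1 hA' i
  by_cases hi' : i ∈ A <;> simp [twoValued, hiA, hi']

theorem isOpen_setOf_apply_preimage {T : Type*} {F : Set K → T} {B : Set K} (hB : B ∈ I)
    (hF : ∀ x y, x ∩ B = y ∩ B → F x = F y) (p : ν) (P : T → Prop) :
    IsOpen[idealTopology I ν] {x | P (F (x ⁻¹' {p}))} := by
  refine isOpen_of_forall_exists_eqOn fun x hx => ⟨B, hB, fun y hy => ?_⟩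
  have hyx : F (y ⁻¹' {p}) = F (x ⁻¹' {p}) := hF _ _ <| by
    simpa only [Set.inter_comm B] using hy.inter_preimage_eq {p}
  rwa [Set.mem_ofPred_eq, hyx]

theorem setOf_isLastEvent_mem_borelClass {κ : Cardinal.{u}} {X : Type u} {τ : TopologicalSpace X}
    {l : Filter κ.ord.ToType} (𝓔 : EventSystem l) {S : X → Set κ.ord.ToType}
    (hS : ∀ i (P : Option (κ.ord.ToType × Bool) → Prop), IsOpen[τ] {x | P (𝓔.event (S x) i)})
    (j : κ.ord.ToType) (ε : Bool) :
    {x | 𝓔.IsLastEvent (S x) j ε} ∈ borelClass κ τ := by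
  have hunion : {x | 𝓔.IsLastEvent (S x) j ε} = ⋃ i, ⋂ i', {x |
      (i' = i → 𝓔.event (S x) i' = some (j, ε)) ∧
        (i' > i → ∀ ε', 𝓔.event (S x) i' ≠ some (j, ε'))} := by
    ext x
    simp [EventSystem.IsLastEvent, forall_and]
  rw [hunion]
  exact isSuccAlgebra_borelClass.iUnion_mem fun i => isSuccAlgebra_borelClass.iInter_mem fun i' =>
    mem_borelClass_of_isOpen (hS i' fun e =>
      (i' = i → e = some (j, ε)) ∧ (i' > i → ∀ ε', e ≠ some (j, ε')))

end IdealTopology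

theorem isRegularCardinalOrder_toType_ord {κ : Cardinal.{u}} (hκ : κ.IsRegular) :
    IsRegularCardinalOrder κ.ord.ToType where
  type_lt_le_ord_cof := by rw [type_toType, cof_toType, hκ.cof_ord]

theorem not_collapses_idealTopology {κ : Cardinal.{max u v}} (hreg : κ.IsRegular) (hunc : ℵ₀ < κ)
    {I : Order.Ideal (Set κ.ord.ToType)} (hproper : I.IsProper) (hcomplete : IsComplete κ I)
    (hbdd : ExtendsBounded I) (ν : Type v) [Nontrivial ν] : ¬ Collapses κ (idealTopology I ν) := by
  have := isRegularCardinalOrder_toType_ord hreg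
  have : Uncountable κ.ord.ToType := by rwa [← aleph0_lt_mk_iff, mk_ord_toType]
  have := neBot_dualFilter hproper
  have : CardinalInterFilter (dualFilter I) #κ.ord.ToType := by
    rw [mk_ord_toType]
    exact hcomplete.cardinalInterFilter_dualFilter
  obtain ⟨l, hl, _, 𝓔, h𝓔⟩ := exists_local_eventSystem (dualFilter_le_atTop hbdd)
  obtain ⟨p, q, hpq⟩ := exists_pair_ne ν
  refine not_collapses_of_forall_exists_mem_iff hunc.le
    (setOf_isLastEvent_mem_borelClass 𝓔 (S := fun x => x ⁻¹' {p}) (fun i P => ?_) · true)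
    fun U hU => ?_
  · obtain ⟨B, hB, hcongr⟩ := h𝓔 i
    exact isOpen_setOf_apply_preimage (compl_mem_dualFilter.1 hB) hcongr p P
  · obtain ⟨A, hA⟩ := 𝓔.exists_forall_mem_iff fun j =>
      (isTraceOpen_preimage_twoValued (hU j) p q).mono hl
    refine ⟨twoValued p q A, fun j => (hA j).trans ?_⟩
    rw [Set.mem_ofPred_eq, preimage_twoValued hpq]

end IdealBorel

theorem mainTheorem1_general (κ : Cardinal.{max u v}) (hreg : κ.IsRegular) (hunc : ℵ₀ < κ)
    (I : Order.Ideal (Set κ.ord.ToType)) (hproper : I.IsProper)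
    (hcomplete : IdealBorel.IsComplete κ I) (hbdd : IdealBorel.ExtendsBounded I)
    (ν : Type v) [Nontrivial ν] :
    ¬ IdealBorel.Collapses κ (IdealBorel.idealTopology I ν) ∧
      IdealBorel.HasFullLength κ (IdealBorel.idealTopology I ν) :=
  have h := IdealBorel.not_collapses_idealTopology hreg hunc hproper hcomplete hbdd ν
  ⟨h, IdealBorel.hasFullLength_of_not_collapses hunc.le h⟩

theorem mainTheorem1 (κ : Cardinal.{u}) (hreg : κ.IsRegular) (hunc : ℵ₀ < κ)
    (I : Order.Ideal (Set κ.ord.ToType)) (hproper : I.IsProper)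
    (hcomplete : IdealBorel.IsComplete κ I) (hbdd : IdealBorel.ExtendsBounded I) :
    (¬ IdealBorel.Collapses κ (IdealBorel.idealTopology I (Fin 2)) ∧
      IdealBorel.HasFullLength κ (IdealBorel.idealTopology I (Fin 2))) ∧
    (¬ IdealBorel.Collapses κ (IdealBorel.idealTopology I κ.ord.ToType) ∧
      IdealBorel.HasFullLength κ (IdealBorel.idealTopology I κ.ord.ToType)) := by
  have : Nontrivial κ.ord.ToType := one_lt_iff_nontrivial.1 <| by
    rw [mk_ord_toType]
    exact one_lt_aleph0.trans hunc
  exact ⟨mainTheorem1_general κ hreg hunc I hproper hcomplete hbdd (Fin 2),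
    mainTheorem1_general κ hreg hunc I hproper hcomplete hbdd κ.ord.ToType⟩
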